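/- **Notation.** For $\theta\in[0,2\pi]$ let $\xi=(\cos\theta,\sin\theta)$ and $\xi^\perp=(-\sin\theta,\cos\theta)$; the pair $(\theta,p)$ stands for the line $\{p\,\xi^\perp+s\,\xi: s\in\mathbb{R}\}$ in $\mathbb{R}^2$. Repeated indices are summed. For a field $f$ of symmetric $2\times2$ tensors on $\mathbb{R}^2$ the Longitudinal Ray Transform is $$If(\theta,p)=\int_{-\infty}^{\infty} f_{ij}(p\,\xi^\perp+s\,\xi)\,\xi_i\xi_j\,ds .$$ $\mathcal{R}$ is the scalar X-ray (Radon) transform $\mathcal{R}\varphi(\theta,p)=\int\varphi(p\,\xi^\perp+s\,\xi)\,ds$; $\mathcal{R}^*h(x)=\int_0^{2\pi}h(\theta,x\cdot\xi^\perp)\,d\theta$ is back projection; $\Lambda$ is the Ram-Lak filter $(-d^2/dp^2)^{1/2}$ in the variable $p$, i.e. the Fourier multiplier $|\kappa|$ with $\kappa$ the angular frequency. The scalar filtered back projection is $\frac1{4\pi}\mathcal{R}^*\Lambda I f$. It is defined pointwise for $f\in C_c^\infty$, and for $f\in L^2$ by continuous extension in $L^2(\mathbb{R}^2)$. If $f$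 is in addition integrable (for instance of bounded support), it is also defined without extension, as the distribution $$\varphi\mapsto\frac1{4\pi}\int_0^{2\pi}\!\int_{\mathbb{R}} If(\theta,p)\,\Lambda\big[\mathcal{R}\varphi(\theta,\cdot)\big](p)\,dp\,d\theta ,\qquad \varphi\in C_c^\infty(\mathbb{R}^2),$$ and the identities below hold in both senses. **1.** Let $f$ be a square-integrable field of symmetric $2\times2$ tensors on $\mathbb{R}^2$. Then $f$ has a Helmholtz decomposition $f=du+{}^sf$, where ${}^sf$ is a square-integrable field of symmetric tensors with $\mathrm{Div}\,{}^sf=0$ on $\mathbb{R}^2$, $u$ is a locally integrable vector field, $(du)_{ij}=\frac12\big(\partial_ju_i+\partial_iu_j\big)$, and all derivatives are in the sense of distributions. For every such decomposition, $$\frac1{4\pi}\mathcal{R}^*\Lambda I f={}^sf_{kk}\quad\text{in }L^2(\mathbb{R}^2).$$ **2.** Let $E,\nu$ be real numbers (Young's modulus and Poisson's ratio) with $E\neq0$, $\nu\neq-1$, $\nu\neq\frac12$. Let $\Omega\subset\mathbb{R}^2$ be open and bounded, and let $\epsilon$ be a square-integrable field of symmetric $3\times3$ tensors which depends on $(x_1,x_2)$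 only and is extended by zero outside $\Omega$. Let $$\sigma_{ij}=C_{ijkl}\epsilon_{kl},\qquad C_{ijkl}=\frac{E}{1+\nu}\Big(\frac{\nu}{1-2\nu}\delta_{ij}\delta_{kl}+\frac12(\delta_{ik}\delta_{jl}+\delta_{il}\delta_{jk})\Big).$$ Suppose that the in-plane part of $\sigma$ is in equilibrium in $\Omega$, $\mathrm{Div}\,\sigma=0$, and is free of traction, $\sigma\cdot n=0$ on $\partial\Omega$, in the weak sense: for all $\varphi\in C_c^\infty(\mathbb{R}^2)$ and $i=1,2$, $\int_\Omega\sum_{j=1}^2\sigma_{ij}\,\partial_j\varphi\,dx=0$. Below, $I\epsilon$ is the Longitudinal Ray Transform of the in-plane part of $\epsilon$, and $\sigma_{kk}=\sigma_{11}+\sigma_{22}$ is the in-plane trace. (a) Under plane-stress conditions ($\sigma_{i3}=0$ for all $i$), $$\frac1{4\pi}\mathcal{R}^*\Lambda I\epsilon=\frac1E\,\sigma_{kk}.$$ (b) Under plane-strain conditions ($\epsilon_{i3}=0$ for all $i$), $$\frac1{4\pi}\mathcal{R}^*\Lambda I\epsilon=\frac{1-\nu^2}{E}\,\sigma_{kk}.$$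 -/

import Mathlib

open MeasureTheory Filter Topology
open scoped FourierTransform ContDiff

noncomputable section

namespace ScalarFBP

/-- The Euclidean plane `ℝ²`. -/
abbrev Plane : Type := EuclideanSpace ℝ (Fin 2)

/-- A field of `2 × 2` matrices on the plane. -/
abbrev TensorField : Type := Plane → Matrix (Fin 2) (Fin 2) ℝ

/-- The unit vector `ξ = (cos θ, sin θ)`. -/
def dir (θ : ℝ) : Plane := !₂[Real.cos θ, Real.sin θ]

/-- The anti-clockwise rotation `ξ^⊥ = (-sin θ, cos θ)` of `ξ` by 90 degrees. -/
def dirPerp (θ : ℝ) : Plane := !₂[-Real.sin θ, Real.cos θ]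

/-! ### The ray transforms, the Ram-Lak filter and back projection

Oriented lines are parametrised by `(θ, p)`: the line is `{p ξ^⊥ + s ξ : s ∈ ℝ}`. -/

/-- Longitudinal ray transform `I f`: the integral of `f_ij ξ_i ξ_j` over the line `(θ, p)`. -/
def lrt (f : TensorField) (θ p : ℝ) : ℝ :=
  ∫ s : ℝ, ∑ i, ∑ j, f (p • dirPerp θ + s • dir θ) i j * dir θ i * dir θ j

/-- Scalar X-ray (Radon) transform `R φ`. -/
def radon (φ : Plane → ℝ) (θ p : ℝ) : ℝ :=
  ∫ s : ℝ, φ (p • dirPerp θ + s • dir θ)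

/-- The Ram-Lak filter `Λ = (-d²/dp²)^(1/2)`. The transform `𝓕` uses the kernel
`exp (-2πi κ p)`, so that `2π|κ|` is the absolute value of the angular frequency. -/
def ramLak (g : ℝ → ℝ) (p : ℝ) : ℝ :=
  (𝓕⁻ (fun κ : ℝ => ((2 * Real.pi * |κ| : ℝ) : ℂ) * 𝓕 (fun q : ℝ => (g q : ℂ)) κ) p).re

/-- Back projection `R^*`: at `x`, integrate over all directions in the unit circle
(total mass `2π`) the value at the line through `x`, which has `p = x · ξ^⊥`. -/
def backProj (h : ℝ → ℝ → ℝ) (x : Plane) : ℝ :=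
  ∫ θ in (0 : ℝ)..(2 * Real.pi), h θ (inner ℝ x (dirPerp θ))

/-- The scalar filtered back projection `(1/4π) R^* Λ I f`, pointwise (for smooth,
compactly supported `f`). -/
def fbp (f : TensorField) (x : Plane) : ℝ :=
  1 / (4 * Real.pi) * backProj (fun θ => ramLak (lrt f θ)) x

/-- `Λ h` as a distribution on `ℝ`, for integrable `h`: `⟨Λ h, χ⟩ = ∫ h Λχ`. -/
def ramLakDistr (h : ℝ → ℝ) (χ : ℝ → ℝ) : ℝ :=
  ∫ p : ℝ, h p * ramLak χ p

/-- `R^* T` as a distribution on the plane, for a family `T θ` of distributions on `ℝ`: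
`⟨R^* T, φ⟩ = ∫ ⟨T θ, R φ(θ, ·)⟩ dθ`. -/
def backProjDistr (T : ℝ → (ℝ → ℝ) → ℝ) (φ : Plane → ℝ) : ℝ :=
  ∫ θ in (0 : ℝ)..(2 * Real.pi), T θ (radon φ θ)

/-- The scalar filtered back projection `(1/4π) R^* Λ I f` as a distribution on the plane
(for integrable `f`, whose line integrals converge on almost every line). -/
def fbpDistr (f : TensorField) (φ : Plane → ℝ) : ℝ :=
  1 / (4 * Real.pi) * backProjDistr (fun θ => ramLakDistr (lrt f θ)) φ

/-! ### Function spaces and weak derivatives -/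

/-- Test functions: `C_c^∞(ℝ²)`. -/
def IsTest (φ : Plane → ℝ) : Prop := ContDiff ℝ ∞ φ ∧ HasCompactSupport φ

/-- `C_c^∞(S²; ℝ²)`. -/
def IsTestTensor (f : TensorField) : Prop :=
  (∀ i j, IsTest (fun x => f x i j)) ∧ ∀ x, (f x).IsSymm

/-- `L²(S²; ℝ²)`: square-integrable fields of symmetric tensors of rank two. -/
def IsL2SymTensor (f : TensorField) : Prop :=
  (∀ i j, MemLp (fun x => f x i j) 2 (volume : Measure Plane)) ∧ ∀ᵐ x : Plane, (f x).IsSymm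

/-- The partial derivative `∂φ/∂x_j`. -/
def pd (j : Fin 2) (φ : Plane → ℝ) (x : Plane) : ℝ :=
  fderiv ℝ φ x (EuclideanSpace.single j 1)

/-- `Div s = 0` on `ℝ²`, in the sense of distributions. -/
def DivFree (s : TensorField) : Prop :=
  ∀ φ, IsTest φ → ∀ i, ∫ x : Plane, ∑ j, s x i j * pd j φ x = 0

/-- `g = d u` on `ℝ²`, in the sense of distributions, with `d` the symmetric gradient
`(d u)_ij = (∂u_i/∂x_j + ∂u_j/∂x_i) / 2`. -/
def IsSymGrad (u : Plane → Fin 2 → ℝ) (g : TensorField) : Prop :=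
  ∀ φ, IsTest φ → ∀ i j,
    ∫ x : Plane, g x i j * φ x
      = -∫ x : Plane, (1 / 2 : ℝ) * (u x i * pd j φ x + u x j * pd i φ x)

/-- `f = d u + s` is a Helmholtz decomposition of `f`: `s` is the solenoidal part, `d u` the
potential part. -/
structure IsHelmholtz (f : TensorField) (u : Plane → Fin 2 → ℝ) (s : TensorField) : Prop where
  l2 : IsL2SymTensor s
  divFree : DivFree s
  locallyIntegrable : LocallyIntegrable u (volume : Measure Plane)
  potential : IsSymGrad u (fun x => f x - s x)

/-- `(1/4π) R^* Λ I f = g` for `f ∈ L²(S²; ℝ²)` and `g ∈ L²(ℝ²)`.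
The operator `(1/4π) R^* Λ I` on `L²` is the continuous extension of the one on `C_c^∞`
(`tendsto`); where the line integrals of `f` themselves converge, `f` being integrable, the
equality holds moreover in the sense of distributions without any extension (`distr`). -/
structure FBPEq (f : TensorField) (g : Plane → ℝ) : Prop where
  memLp : MemLp g 2 (volume : Measure Plane)
  tendsto : ∀ F : ℕ → TensorField, (∀ n, IsTestTensor (F n)) →
    (∀ i j, Tendsto (fun n => eLpNorm (fun x => F n x i j - f x i j) 2 (volume : Measure Plane))
      atTop (𝓝 0)) →
    Tendsto (fun n => eLpNorm (fun x => fbp (F n) x - g x) 2 (volume : Measure Plane))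
      atTop (𝓝 0)
  distr : (∀ i j, Integrable (fun x => f x i j) (volume : Measure Plane)) →
    ∀ φ, IsTest φ → fbpDistr f φ = ∫ x : Plane, g x * φ x

/-! ### Elasticity

Stress and strain are `3 × 3` tensors which depend on the in-plane position only; the third
axis has index `2`. -/

/-- A field of `3 × 3` matrices on the plane. -/
abbrev TensorField3 : Type := Plane → Matrix (Fin 3) (Fin 3) ℝ

/-- Kronecker's delta. -/
def kron (i j : Fin 3) : ℝ := if i = j then 1 else 0

/-- The isotropic stiffness tensor with Young's modulus `E` and Poisson's ratio `ν`. -/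
def stiffness (E ν : ℝ) (i j k l : Fin 3) : ℝ :=
  E / (1 + ν) * (ν / (1 - 2 * ν) * (kron i j * kron k l)
    + 1 / 2 * (kron i k * kron j l + kron i l * kron j k))

/-- Hooke's law `σ = C : ε`. -/
def stress (E ν : ℝ) (ε : TensorField3) : TensorField3 :=
  fun x => Matrix.of fun i j => ∑ k, ∑ l, stiffness E ν i j k l * ε x k l

/-- The in-plane part of a `3 × 3` tensor field. -/
def inPlane (a : TensorField3) : TensorField :=
  fun x => (a x).submatrix Fin.castSucc Fin.castSucc

/-- A square-integrable strain field on the sample `Ω`, extended by zero. -/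
structure IsStrainField (Ω : Set Plane) (ε : TensorField3) : Prop where
  l2 : ∀ i j, MemLp (fun x => ε x i j) 2 (volume : Measure Plane)
  symm : ∀ᵐ x : Plane, (ε x).IsSymm
  zero_outside : ∀ x, x ∉ Ω → ε x = 0

/-- Plane stress: `σ_i3 = 0` for all `i`. -/
def PlaneStress (σ : TensorField3) : Prop := ∀ᵐ x : Plane, ∀ i, σ x i 2 = 0

/-- Plane strain: `ε_i3 = 0` for all `i`. -/
def PlaneStrain (ε : TensorField3) : Prop := ∀ᵐ x : Plane, ∀ i, ε x i 2 = 0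

/-- Equilibrium without body forces: `Div σ = 0` in `Ω`, in the sense of distributions. -/
def Equilibrium (Ω : Set Plane) (σ : TensorField) : Prop :=
  ∀ φ, IsTest φ → tsupport φ ⊆ Ω → ∀ i, ∫ x in Ω, ∑ j, σ x i j * pd j φ x = 0

/-- The boundary traction `σ · n` of a square-integrable stress field which is in equilibrium in
`Ω`, as a functional of the values of `φ` on `∂Ω`: where `σ` and `∂Ω` are regular, this is
`∫_∂Ω (σ · n)_i φ dS`, by Green's formula. -/
def traction (Ω : Set Plane) (σ : TensorField) (i : Fin 2) (φ : Plane → ℝ) : ℝ :=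
  ∫ x in Ω, ∑ j, σ x i j * pd j φ x

/-- No boundary traction: `σ · n = 0` on `∂Ω`, in the weak sense. -/
def TractionFree (Ω : Set Plane) (σ : TensorField) : Prop :=
  ∀ φ, IsTest φ → ∀ i, traction Ω σ i φ = 0

end ScalarFBP

end

noncomputable section

namespace ScalarFBP

open scoped SchwartzMap ComplexConjugate ENNReal

section

/-! ### The Fourier transform of square-integrable functions -/

/-! For fixed `θ` the weights `ξ_i ξ_j` are constants, so `I f(θ, ·)` is the Radon transform of the
scalar `f_ij ξ_i ξ_j`. By the Fourier slice theorem (`fourier_radon`) its transform in `p` is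
`f̂_ij(κ ξ^⊥) ξ_i ξ_j`. At the frequency `k = κ ξ^⊥` one has `ξ_i ξ_j = k^⊥_i k^⊥_j / |k|²`, and the
filter `|κ|` is the Jacobian of polar coordinates. Hence the scalar filtered back projection is the
Fourier multiplier `ĝ = (k^⊥_i k^⊥_j / |k|²) f̂_ij` (`integral_dir_mul_filteredSlice`, `SymbolRel`).

The symbol is bounded by 1, so Plancherel gives continuity in `L²` (`SymbolRel.tendsto_fbp`). It is
real, so the multiplier is self-adjoint and can be moved between field and test function, which
covers the distributional definition (`SymbolRel.fbpDistr_eq`). What remains is algebra at almost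
every frequency. Contraction with `k^⊥ ⊗ k^⊥` annihilates symmetric gradients (`IsSymGrad.symbol`).
On a solenoidal field, where `k_j ŝ_ij = 0`, it gives `|k|²` times the trace (`DivFree.symbolRel`).

A traction-free stress, extended by zero, is solenoidal on the whole plane. Hooke's law writes the
in-plane strain as `a σ - b (tr σ) Id`, and the multiplier sends this to `(a - b) tr σ` because the
symbol itself has trace 1.

For existence (`exists_isHelmholtz`), `ŝ` is the component of `f̂` along `k^⊥ ⊗ k^⊥`, and `û` solves
the remaining linear system. Only `|k| û` is square-integrable, so the low frequencies of `u` are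
renormalised at the origin. -/

/-- The Fourier transform on `L²`, on functions; zero outside `L²`. -/
def l2Fourier (f : Plane → ℂ) : Plane → ℂ :=
  open Classical in
  if hf : MemLp f 2 (volume : Measure Plane) then ⇑(𝓕 (hf.toLp f) : Lp (α := Plane) ℂ 2 volume)
  else 0

/-- The inverse Fourier transform on `L²`, on functions; zero outside `L²`. -/
def l2FourierInv (f : Plane → ℂ) : Plane → ℂ :=
  open Classical in
  if hf : MemLp f 2 (volume : Measure Plane) then ⇑(𝓕⁻ (hf.toLp f) : Lp (α := Plane) ℂ 2 volume)
  else 0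

variable {f g : Plane → ℂ}

theorem l2Fourier_of_memLp (hf : MemLp f 2 (volume : Measure Plane)) :
    l2Fourier f = ⇑(𝓕 (hf.toLp f) : Lp (α := Plane) ℂ 2 volume) := dif_pos hf

theorem l2FourierInv_of_memLp (hf : MemLp f 2 (volume : Measure Plane)) :
    l2FourierInv f = ⇑(𝓕⁻ (hf.toLp f) : Lp (α := Plane) ℂ 2 volume) := dif_pos hf

theorem memLp_l2Fourier (f : Plane → ℂ) : MemLp (l2Fourier f) 2 (volume : Measure Plane) := by
  by_cases hf : MemLp f 2 (volume : Measure Plane)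
  · rw [l2Fourier_of_memLp hf]; exact Lp.memLp _
  -- The default value 0 is itself in `L²`, so membership needs no hypothesis on `f`.
  · rw [l2Fourier, dif_neg hf]; exact MemLp.zero

theorem memLp_l2FourierInv (f : Plane → ℂ) :
    MemLp (l2FourierInv f) 2 (volume : Measure Plane) := by
  by_cases hf : MemLp f 2 (volume : Measure Plane)
  · rw [l2FourierInv_of_memLp hf]; exact Lp.memLp _
  · rw [l2FourierInv, dif_neg hf]; exact MemLp.zero

theorem toLp_l2Fourier (hf : MemLp f 2 (volume : Measure Plane)) :
    (memLp_l2Fourier f).toLp _ = 𝓕 (hf.toLp f) := by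
  apply Lp.ext
  exact (MemLp.coeFn_toLp _).trans (by rw [l2Fourier_of_memLp hf])

theorem toLp_l2FourierInv (hf : MemLp f 2 (volume : Measure Plane)) :
    (memLp_l2FourierInv f).toLp _ = 𝓕⁻ (hf.toLp f) := by
  apply Lp.ext
  exact (MemLp.coeFn_toLp _).trans (by rw [l2FourierInv_of_memLp hf])

theorem l2Fourier_l2FourierInv (hf : MemLp f 2 (volume : Measure Plane)) :
    l2Fourier (l2FourierInv f) =ᵐ[volume] f := by
  rw [l2Fourier_of_memLp (memLp_l2FourierInv f), toLp_l2FourierInv hf,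
    FourierTransform.fourier_fourierInv_eq]
  exact hf.coeFn_toLp

theorem l2FourierInv_l2Fourier (hf : MemLp f 2 (volume : Measure Plane)) :
    l2FourierInv (l2Fourier f) =ᵐ[volume] f := by
  rw [l2FourierInv_of_memLp (memLp_l2Fourier f), toLp_l2Fourier hf,
    FourierTransform.fourierInv_fourier_eq]
  exact hf.coeFn_toLp

theorem l2Fourier_add (hf : MemLp f 2 (volume : Measure Plane))
    (hg : MemLp g 2 (volume : Measure Plane)) :
    l2Fourier (fun x => f x + g x) =ᵐ[volume] fun k => l2Fourier f k + l2Fourier g k := by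
  have h : MemLp (fun x => f x + g x) 2 (volume : Measure Plane) := hf.add hg
  have e : h.toLp = hf.toLp + hg.toLp := rfl
  rw [l2Fourier_of_memLp h, l2Fourier_of_memLp hf, l2Fourier_of_memLp hg, e,
    FourierTransform.fourier_add]
  exact Lp.coeFn_add _ _

theorem l2Fourier_const_mul (c : ℂ) (hf : MemLp f 2 (volume : Measure Plane)) :
    l2Fourier (fun x => c * f x) =ᵐ[volume] fun k => c * l2Fourier f k := by
  have h : MemLp (fun x => c * f x) 2 (volume : Measure Plane) := hf.const_mul c
  have e : h.toLp = c • hf.toLp := rfl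
  rw [l2Fourier_of_memLp h, l2Fourier_of_memLp hf, e, FourierTransform.fourier_smul]
  exact Lp.coeFn_smul _ _

theorem l2FourierInv_sub (hf : MemLp f 2 (volume : Measure Plane))
    (hg : MemLp g 2 (volume : Measure Plane)) :
    l2FourierInv (fun x => f x - g x)
      =ᵐ[volume] fun k => l2FourierInv f k - l2FourierInv g k := by
  have h : MemLp (fun x => f x - g x) 2 (volume : Measure Plane) := hf.sub hg
  have e : h.toLp = hf.toLp - hg.toLp := rfl
  rw [l2FourierInv_of_memLp h, l2FourierInv_of_memLp hf, l2FourierInv_of_memLp hg, e]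
  have : 𝓕⁻ (hf.toLp f - hg.toLp g) = 𝓕⁻ (hf.toLp f) - 𝓕⁻ (hg.toLp g) :=
    (Lp.fourierTransformₗᵢ Plane ℂ).symm.map_sub _ _
  rw [this]
  exact Lp.coeFn_sub _ _

theorem l2Fourier_sub (hf : MemLp f 2 (volume : Measure Plane))
    (hg : MemLp g 2 (volume : Measure Plane)) :
    l2Fourier (fun x => f x - g x) =ᵐ[volume] fun k => l2Fourier f k - l2Fourier g k := by
  have h := l2Fourier_add hf (hg.const_mul (-1))
  filter_upwards [h, l2Fourier_const_mul (-1) hg] with k h1 h2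
  simp only [neg_one_mul] at h1 h2
  simpa only [h2, sub_eq_add_neg] using h1

theorem l2Fourier_congr (h : f =ᵐ[volume] g) : l2Fourier f = l2Fourier g := by
  by_cases hf : MemLp f 2 (volume : Measure Plane)
  · have hg := (memLp_congr_ae h).1 hf
    rw [l2Fourier_of_memLp hf, l2Fourier_of_memLp hg, MemLp.toLp_congr hf hg h]
  · have hg := mt (memLp_congr_ae h).2 hf
    rw [l2Fourier, l2Fourier, dif_neg hf, dif_neg hg]

theorem l2FourierInv_congr (h : f =ᵐ[volume] g) : l2FourierInv f = l2FourierInv g := by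
  by_cases hf : MemLp f 2 (volume : Measure Plane)
  · have hg := (memLp_congr_ae h).1 hf
    rw [l2FourierInv_of_memLp hf, l2FourierInv_of_memLp hg, MemLp.toLp_congr hf hg h]
  · have hg := mt (memLp_congr_ae h).2 hf
    rw [l2FourierInv, l2FourierInv, dif_neg hf, dif_neg hg]

theorem eLpNorm_l2Fourier (hf : MemLp f 2 (volume : Measure Plane)) :
    eLpNorm (l2Fourier f) 2 volume = eLpNorm f 2 volume := by
  have h : ‖𝓕 (hf.toLp f)‖ₑ = ‖hf.toLp f‖ₑ := by
    rw [← ofReal_norm, ← ofReal_norm, Lp.norm_fourier_eq]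
  rw [l2Fourier_of_memLp hf, ← Lp.enorm_def, h, Lp.enorm_toLp]

theorem eLpNorm_l2FourierInv (hf : MemLp f 2 (volume : Measure Plane)) :
    eLpNorm (l2FourierInv f) 2 volume = eLpNorm f 2 volume := by
  rw [← eLpNorm_l2Fourier (memLp_l2FourierInv f)]
  exact eLpNorm_congr_ae (l2Fourier_l2FourierInv hf)

/-- The `L²` transform agrees with that of tempered distributions, which is defined by moving `𝓕`
onto the test function. -/
theorem integral_mul_l2Fourier (ψ : 𝓢(Plane, ℂ)) (hf : MemLp f 2 (volume : Measure Plane)) :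
    ∫ k, ψ k * l2Fourier f k = ∫ x, 𝓕 (ψ : Plane → ℂ) x * f x := by
  have h := congrArg (fun T : 𝓢'(Plane, ℂ) => T ψ)
    (Lp.fourier_toTemperedDistribution_eq (hf.toLp f))
  simp only [TemperedDistribution.fourier_apply, Lp.toTemperedDistribution_apply] at h
  rw [l2Fourier_of_memLp hf]
  simp only [smul_eq_mul] at h
  rw [← h]
  refine integral_congr_ae ?_
  filter_upwards [hf.coeFn_toLp] with x hx
  rw [hx, SchwartzMap.fourier_coe]

theorem integral_mul_l2FourierInv (ψ : 𝓢(Plane, ℂ)) (hf : MemLp f 2 (volume : Measure Plane)) :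
    ∫ k, ψ k * l2FourierInv f k = ∫ x, 𝓕⁻ (ψ : Plane → ℂ) x * f x := by
  have h := congrArg (fun T : 𝓢'(Plane, ℂ) => T ψ)
    (Lp.fourierInv_toTemperedDistribution_eq (hf.toLp f))
  simp only [TemperedDistribution.fourierInv_apply, Lp.toTemperedDistribution_apply] at h
  rw [l2FourierInv_of_memLp hf]
  simp only [smul_eq_mul] at h
  rw [← h]
  refine integral_congr_ae ?_
  filter_upwards [hf.coeFn_toLp] with x hx
  rw [hx, SchwartzMap.fourierInv_coe]

theorem integral_mul_eq_integral_fourierInv_mul (ψ : 𝓢(Plane, ℂ))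
    (hf : MemLp f 2 (volume : Measure Plane)) :
    ∫ x, ψ x * f x = ∫ k, 𝓕⁻ (ψ : Plane → ℂ) k * l2Fourier f k := by
  have h := integral_mul_l2Fourier (𝓕⁻ ψ) hf
  rw [← SchwartzMap.fourier_coe, FourierTransform.fourier_fourierInv_eq] at h
  rw [← h, SchwartzMap.fourierInv_coe]

/-- Plancherel in sesquilinear form, for a pair in which neither function is smooth. It carries a
multiplier from the test function to the field. -/
theorem integral_conj_mul_l2FourierInv (hf : MemLp f 2 (volume : Measure Plane))
    (hg : MemLp g 2 (volume : Measure Plane)) :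
    ∫ x, conj (f x) * l2FourierInv g x = ∫ k, conj (l2Fourier f k) * g k := by
  have h := Lp.inner_fourier_eq (hf.toLp f) ((memLp_l2FourierInv g).toLp _)
  rw [← toLp_l2Fourier hf, toLp_l2FourierInv hg, FourierTransform.fourier_fourierInv_eq,
    ← toLp_l2FourierInv hg] at h
  rw [L2.inner_def, L2.inner_def] at h
  have e1 : ∫ k, conj (l2Fourier f k) * g k
      = ∫ k, inner ℂ ((memLp_l2Fourier f).toLp _ k) (hg.toLp g k) := by
    refine integral_congr_ae ?_
    filter_upwards [(memLp_l2Fourier f).coeFn_toLp, hg.coeFn_toLp] with k h1 h2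
    rw [h1, h2, RCLike.inner_apply']
  have e2 : ∫ k, conj (f k) * l2FourierInv g k
      = ∫ k, inner ℂ (hf.toLp f k) ((memLp_l2FourierInv g).toLp _ k) := by
    refine integral_congr_ae ?_
    filter_upwards [(memLp_l2FourierInv g).coeFn_toLp, hf.coeFn_toLp] with k h1 h2
    rw [h1, h2, RCLike.inner_apply']
  rw [e1, e2, h]

theorem l2Fourier_schwartz (ψ : 𝓢(Plane, ℂ)) :
    l2Fourier ψ =ᵐ[volume] 𝓕 (ψ : Plane → ℂ) := by
  rw [l2Fourier_of_memLp (ψ.memLp 2), ← SchwartzMap.fourier_coe]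
  exact (congrArg (fun u : Lp (α := Plane) ℂ 2 volume => (u : Plane → ℂ))
    (SchwartzMap.toLp_fourier_eq ψ)).eventuallyEq.trans (SchwartzMap.coeFn_toLp _ _ _)

theorem integral_mul_fourierInv (hf : Integrable f) (hg : Integrable g) :
    ∫ k, g k * 𝓕⁻ f k = ∫ x, 𝓕⁻ g x * f x := by
  -- Fubini with a kernel symmetric in both variables; the form `-innerₗ` turns the forward
  -- transform into the inverse one.
  have h := VectorFourier.integral_fourierIntegral_smul_eq_flip (e := Real.fourierChar)
    (L := -innerₗ Plane) (f := g) (g := f) (μ := volume) (ν := volume)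
    Real.continuous_fourierChar (by
      simp only [LinearMap.neg_apply, innerₗ_apply_apply]; fun_prop) hg hf
  have e1 : ∀ u : Plane → ℂ, VectorFourier.fourierIntegral Real.fourierChar volume
      (-innerₗ Plane) u = 𝓕⁻ u := by
    intro u; ext w
    simp [VectorFourier.fourierIntegral, Real.fourierInv_eq]
  have e2 : ∀ u : Plane → ℂ, VectorFourier.fourierIntegral Real.fourierChar volume
      (-innerₗ Plane).flip u = 𝓕⁻ u := by
    intro u; ext w
    simp [VectorFourier.fourierIntegral, Real.fourierInv_eq, real_inner_comm]
  rw [e1, e2] at h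
  simpa using h.symm

theorem continuous_fourierInv (hf : Integrable f) : Continuous (𝓕⁻ f) := by
  have : 𝓕⁻ f = fun x => 𝓕 f (-x) := by ext x; exact Real.fourierInv_eq_fourier_neg f x
  rw [this]
  exact (VectorFourier.fourierIntegral_continuous Real.continuous_fourierChar
    (by simp only [innerₗ_apply_apply]; fun_prop) hf).comp continuous_neg

/-- A locally integrable function is determined by its integrals against Schwartz functions. -/
theorem ae_eq_of_integral_schwartz_mul_eq (hf : LocallyIntegrable f) (hg : LocallyIntegrable g)
    (h : ∀ ψ : 𝓢(Plane, ℂ), ∫ x, ψ x * f x = ∫ x, ψ x * g x) : f =ᵐ[volume] g := by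
  have key := ae_eq_zero_of_integral_contDiff_smul_eq_zero (hf.sub hg) (fun φ h1 h2 => by
    have h3 : HasCompactSupport (fun x => (φ x : ℂ)) := h2.comp_left (g := Complex.ofReal) rfl
    have h4 : ContDiff ℝ ∞ (fun x => (φ x : ℂ)) := Complex.ofRealCLM.contDiff.comp h1
    have h5 := h (h3.toSchwartzMap h4)
    simp only [HasCompactSupport.toSchwartzMap_toFun] at h5
    have i1 := hf.integrable_smul_left_of_hasCompactSupport h1.continuous h2
    have i2 := hg.integrable_smul_left_of_hasCompactSupport h1.continuous h2
    simp only [Pi.sub_apply, smul_sub]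
    rw [integral_sub i1 i2]
    simpa [sub_eq_zero] using h5)
  filter_upwards [key] with x hx
  exact sub_eq_zero.1 hx

theorem locallyIntegrable_of_memLp (hf : MemLp f 2 (volume : Measure Plane)) :
    LocallyIntegrable f := hf.locallyIntegrable (by norm_num)

/-- Both sides have the same pairing with every Schwartz function. This is needed beyond the
Schwartz class, since `perpSymbol` is discontinuous at the origin. -/
theorem l2FourierInv_eq_fourierInv (hf : MemLp f 2 (volume : Measure Plane))
    (h1 : Integrable f) : l2FourierInv f =ᵐ[volume] 𝓕⁻ f := by
  refine ae_eq_of_integral_schwartz_mul_eq (locallyIntegrable_of_memLp (memLp_l2FourierInv f))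
    (continuous_fourierInv h1).locallyIntegrable fun ψ => ?_
  rw [integral_mul_l2FourierInv ψ hf, integral_mul_fourierInv h1 ψ.integrable]

/-- The Fourier transform is injective on integrable functions. -/
theorem ae_eq_zero_of_fourierInv_eq_zero (hf : Integrable f) (h : ∀ x, 𝓕⁻ f x = 0) :
    f =ᵐ[volume] 0 := by
  refine ae_eq_of_integral_schwartz_mul_eq hf.locallyIntegrable
    (locallyIntegrable_const (0 : ℂ)) fun ψ => ?_
  -- Every Schwartz function is `𝓕⁻` of one; the transform moves onto `f`, where it vanishes.
  have e := integral_mul_fourierInv hf (𝓕 ψ).integrable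
  rw [← SchwartzMap.fourierInv_coe, FourierTransform.fourierInv_fourier_eq] at e
  rw [← e]
  simp [h]

end

section

/-! ### Test functions and their Fourier transforms -/

/-- A real function on the plane, as a complex function. -/
abbrev toC (φ : Plane → ℝ) : Plane → ℂ := fun x => (φ x : ℂ)

theorem memLp_toC {φ : Plane → ℝ} (h : MemLp φ 2 (volume : Measure Plane)) :
    MemLp (toC φ) 2 (volume : Measure Plane) := h.ofReal

namespace IsTest

variable {φ χ : Plane → ℝ}

theorem hasCompactSupport_toC (hφ : IsTest φ) : HasCompactSupport (toC φ) :=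
  hφ.2.comp_left (g := Complex.ofReal) rfl

theorem contDiff_toC (hφ : IsTest φ) : ContDiff ℝ ∞ (toC φ) :=
  Complex.ofRealCLM.contDiff.comp hφ.1

/-- A test function as a Schwartz function. -/
def schwartz (hφ : IsTest φ) : 𝓢(Plane, ℂ) :=
  hφ.hasCompactSupport_toC.toSchwartzMap hφ.contDiff_toC

theorem coe_schwartz (hφ : IsTest φ) : (hφ.schwartz : Plane → ℂ) = toC φ := by
  ext x; simp [schwartz]

theorem continuous (hφ : IsTest φ) : Continuous φ := hφ.1.continuous

theorem integrable (hφ : IsTest φ) : Integrable φ :=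
  hφ.continuous.integrable_of_hasCompactSupport hφ.2

theorem memLp (hφ : IsTest φ) (p : ℝ≥0∞) : MemLp φ p (volume : Measure Plane) :=
  hφ.continuous.memLp_of_hasCompactSupport hφ.2

theorem pd (hφ : IsTest φ) (j : Fin 2) : IsTest (pd j φ) :=
  ⟨(hφ.1.fderiv_right (m := ∞) (by simp)).clm_apply contDiff_const,
    hφ.2.fderiv_apply (𝕜 := ℝ) (EuclideanSpace.single j 1)⟩

theorem const_mul (hφ : IsTest φ) (c : ℝ) : IsTest (fun x => c * φ x) :=
  ⟨contDiff_const.mul hφ.1, hφ.2.mul_left⟩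

theorem neg (hφ : IsTest φ) : IsTest (fun x => -φ x) :=
  ⟨hφ.1.neg, hφ.2.comp_left (g := fun y : ℝ => -y) neg_zero⟩

theorem add (hφ : IsTest φ) (hχ : IsTest χ) : IsTest (fun x => φ x + χ x) :=
  ⟨hφ.1.add hχ.1, hφ.2.add hχ.2⟩

theorem sum {ι : Type*} (s : Finset ι) {ψ : ι → Plane → ℝ} (h : ∀ i, IsTest (ψ i)) :
    IsTest (fun x => ∑ i ∈ s, ψ i x) := by
  classical
  induction s using Finset.induction_on with
  | empty => exact ⟨by simpa using contDiff_const,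
      by simpa using! (HasCompactSupport.zero : HasCompactSupport (0 : Plane → ℝ))⟩
  | insert a s ha ih => simp only [Finset.sum_insert ha]; exact (h a).add ih

theorem comp_sub (hφ : IsTest φ) (y : Plane) : IsTest (fun x => φ (x - y)) :=
  ⟨hφ.1.comp (contDiff_id.sub contDiff_const),
    by simpa [sub_eq_add_neg, Function.comp_def] using
      hφ.2.comp_homeomorph (Homeomorph.addRight (-y))⟩

/-- The kernel of `𝓕⁻` is `exp (+2πi⟨x, k⟩)`, hence the minus sign after integration by parts. -/
theorem fourierInv_pd (hφ : IsTest φ) (j : Fin 2) (k : Plane) :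
    𝓕⁻ (toC (ScalarFBP.pd j φ)) k = -(2 * Real.pi * Complex.I * k j) * 𝓕⁻ (toC φ) k := by
  have h := SchwartzMap.fourierInv_lineDerivOp_eq hφ.schwartz (EuclideanSpace.single j (1 : ℝ))
  have h1 : ((LineDeriv.lineDerivOp (EuclideanSpace.single j (1 : ℝ)) hφ.schwartz :
      𝓢(Plane, ℂ)) : Plane → ℂ) = toC (ScalarFBP.pd j φ) := by
    ext x
    rw [SchwartzMap.lineDerivOp_apply_eq_fderiv, coe_schwartz]
    have := (Complex.ofRealCLM.hasFDerivAt (x := φ x)).comp x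
      ((hφ.1.differentiable (by simp)) x).hasFDerivAt
    have e : toC φ = ⇑Complex.ofRealCLM ∘ φ := rfl
    rw [e, this.fderiv]
    simp [ScalarFBP.pd]
  have h2 := congrArg (fun u : 𝓢(Plane, ℂ) => u k) h
  simp only [SchwartzMap.fourierInv_coe, h1] at h2
  rw [h2, smul_apply, SchwartzMap.smulLeftCLM_apply_apply (by fun_prop),
    SchwartzMap.fourierInv_coe, coe_schwartz]
  simp [EuclideanSpace.inner_single_right]
  ring

theorem fourierInv_neg (k : Plane) :
    𝓕⁻ (toC (fun x => -φ x)) k = -𝓕⁻ (toC φ) k := by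
  simp [Real.fourierInv_eq, integral_neg, Circle.smul_def]

/-- Translation becomes modulation: an identity valid for all translates of one test function says
that a whole inverse Fourier transform vanishes. -/
theorem fourierInv_comp_sub (y k : Plane) :
    𝓕⁻ (toC (fun x => φ (x - y))) k = Real.fourierChar (inner ℝ k y) • 𝓕⁻ (toC φ) k := by
  rw [Real.fourierInv_eq, Real.fourierInv_eq,
    ← integral_add_right_eq_self _ y, Circle.smul_def, ← integral_smul]
  refine integral_congr_ae (Eventually.of_forall fun x => ?_)
  simp [inner_add_left, AddChar.map_add_eq_mul, Circle.smul_def, real_inner_comm y k, toC]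
  ring

theorem memLp_fourierInv (hφ : IsTest φ) :
    MemLp (𝓕⁻ (toC φ)) 2 (volume : Measure Plane) := by
  rw [← hφ.coe_schwartz, ← SchwartzMap.fourierInv_coe]
  exact (𝓕⁻ hφ.schwartz).memLp 2

theorem integral_mul_complex (hφ : IsTest φ) {f : Plane → ℂ}
    (hf : MemLp f 2 (volume : Measure Plane)) :
    ∫ x, toC φ x * f x = ∫ k, 𝓕⁻ (toC φ) k * l2Fourier f k := by
  simpa [hφ.coe_schwartz] using integral_mul_eq_integral_fourierInv_mul hφ.schwartz hf

theorem integral_mul (hφ : IsTest φ) {h : Plane → ℝ}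
    (hh : MemLp h 2 (volume : Measure Plane)) :
    ((∫ x, h x * φ x : ℝ) : ℂ) = ∫ k, 𝓕⁻ (toC φ) k * l2Fourier (toC h) k := by
  rw [← hφ.integral_mul_complex (memLp_toC hh), ← integral_complex_ofReal]
  simp [mul_comm]

end IsTest

/-- The inverse Fourier transform of a non-negative test function with support near the origin
has no zero in a large ball. -/
theorem fourierInv_ne_zero_of_nonneg {φ : Plane → ℝ} (hφ : IsTest φ) (hnn : ∀ x, 0 ≤ φ x)
    (h0 : φ 0 ≠ 0) {r R : ℝ} (hr : 2 * Real.pi * (r * R) ≤ 1)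
    (hs : ∀ x, r ≤ ‖x‖ → φ x = 0) {k : Plane} (hk : ‖k‖ < R) : 𝓕⁻ (toC φ) k ≠ 0 := by
  intro hz
  have hc := hφ.continuous
  have hint : Integrable (fun x : Plane =>
      Complex.exp (↑(2 * Real.pi * inner ℝ x k) * Complex.I) • toC φ x) := by
    have hs : HasCompactSupport ((fun x : Plane =>
        Complex.exp (↑(2 * Real.pi * inner ℝ x k) * Complex.I)) • toC φ) :=
      hφ.hasCompactSupport_toC.smul_left
    refine Continuous.integrable_of_hasCompactSupport ?_ hs
    have hc' := hφ.contDiff_toC.continuous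
    fun_prop
  have hre : (𝓕⁻ (toC φ) k).re = ∫ x : Plane, Real.cos (2 * Real.pi * inner ℝ x k) * φ x := by
    rw [Real.fourierInv_eq', ← Complex.reCLM_apply, ← Complex.reCLM.integral_comp_comm hint]
    refine integral_congr_ae (Eventually.of_forall fun x => ?_)
    simp only [Complex.reCLM_apply, smul_eq_mul, toC, Complex.re_mul_ofReal,
      Complex.exp_ofReal_mul_I_re]
  -- Where `φ` does not vanish, the phase is at most 1 in absolute value, below `π / 2`, so the
  -- cosine is non-negative there; at the origin it is 1.
  have hpos : 0 < ∫ x : Plane, Real.cos (2 * Real.pi * inner ℝ x k) * φ x := by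
    refine Continuous.integral_pos_of_hasCompactSupport_nonneg_nonzero (x := 0)
      (by fun_prop) hφ.2.mul_left (fun x => ?_) (by simpa using h0)
    by_cases hx : r ≤ ‖x‖
    · simp [hs x hx]
    · have h1 : |inner ℝ x k| ≤ r * R :=
        (abs_real_inner_le_norm x k).trans
          (mul_le_mul (not_le.1 hx).le hk.le (norm_nonneg _) ((norm_nonneg x).trans (not_le.1 hx).le))
      have h2 : |2 * Real.pi * inner ℝ x k| ≤ 1 := by
        rw [abs_mul, abs_of_pos (by positivity : 0 < 2 * Real.pi)]
        exact (mul_le_mul_of_nonneg_left h1 (by positivity)).trans hr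
      have h3 := abs_le.1 h2
      have h4 := Real.pi_gt_three
      exact mul_nonneg (Real.cos_nonneg_of_mem_Icc ⟨by linarith, by linarith⟩) (hnn x)
  rw [← hre, hz] at hpos
  simp at hpos

/-- There are test functions whose Fourier transform has no zero in a given ball. -/
theorem exists_isTest_fourierInv_ne_zero {R : ℝ} (hR : 0 < R) :
    ∃ φ, IsTest φ ∧ ∀ k : Plane, ‖k‖ < R → 𝓕⁻ (toC φ) k ≠ 0 := by
  -- The outer radius is chosen so that `2π · rOut · R = 1`, the limit on the phase.
  obtain ⟨b, hb⟩ : ∃ b : ContDiffBump (0 : Plane), b.rOut = 1 / (2 * Real.pi * R) := by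
    have hr : 0 < 1 / (2 * Real.pi * R) := by positivity
    exact ⟨⟨1 / (2 * Real.pi * R) / 2, 1 / (2 * Real.pi * R), by positivity, by linarith⟩, rfl⟩
  refine ⟨b, ⟨b.contDiff, b.hasCompactSupport⟩, fun k hk =>
    fourierInv_ne_zero_of_nonneg ⟨b.contDiff, b.hasCompactSupport⟩ (fun x => b.nonneg) ?_
      (r := b.rOut) (R := R) ?_ (fun x hx => ?_) hk⟩
  · simp [b.one_of_mem_closedBall (Metric.mem_closedBall_self b.rIn_pos.le)]
  · rw [hb]
    exact le_of_eq (by field_simp)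
  · exact b.zero_of_le_dist (by simpa using hx)

/-- If square-integrable functions satisfy a linear partial differential equation in the sense of
distributions, their Fourier transforms satisfy the corresponding symbol relation. -/
theorem ae_sum_symbol_mul_l2Fourier_eq_zero {ι : Type*} [Fintype ι] {h : ι → Plane → ℝ}
    (hh : ∀ a, MemLp (h a) 2 (volume : Measure Plane)) {D : ι → (Plane → ℝ) → Plane → ℝ}
    {p : ι → Plane → ℂ} (hD : ∀ a φ, IsTest φ → IsTest (D a φ))
    (hp : ∀ a φ, IsTest φ → ∀ k, 𝓕⁻ (toC (D a φ)) k = p a k * 𝓕⁻ (toC φ) k)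
    (H : ∀ φ, IsTest φ → ∑ a, ∫ x, h a x * D a φ x = 0) :
    ∀ᵐ k : Plane, ∑ a, p a k * l2Fourier (toC (h a)) k = 0 := by
  -- The symbol may be unbounded, but its product with the transform of `φ` is the transform of the
  -- test function `D a φ`, hence in `L²`.
  have hi : ∀ a φ, IsTest φ →
      Integrable (fun k => p a k * 𝓕⁻ (toC φ) k * l2Fourier (toC (h a)) k) := by
    intro a φ hφ
    have := (hD a φ hφ).memLp_fourierInv.integrable_mul (memLp_l2Fourier (toC (h a)))
    refine this.congr (Eventually.of_forall fun k => ?_)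
    simp only [Pi.mul_apply, hp a φ hφ]
  have hG : ∀ φ, IsTest φ →
      ∫ k, ∑ a, p a k * 𝓕⁻ (toC φ) k * l2Fourier (toC (h a)) k = 0 := by
    intro φ hφ
    rw [integral_finsetSum _ fun a _ => hi a φ hφ]
    have := congrArg (fun t : ℝ => (t : ℂ)) (H φ hφ)
    simp only [Complex.ofReal_sum, Complex.ofReal_zero] at this
    rw [← this]
    refine Finset.sum_congr rfl fun a _ => ?_
    rw [(hD a φ hφ).integral_mul (hh a)]
    simp only [hp a φ hφ]
  have key : ∀ φ, IsTest φ →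
      (fun k => ∑ a, p a k * 𝓕⁻ (toC φ) k * l2Fourier (toC (h a)) k) =ᵐ[volume] 0 := by
    intro φ hφ
    refine ae_eq_zero_of_fourierInv_eq_zero (integrable_finsetSum _ fun a _ => hi a φ hφ)
      fun y => ?_
    -- The inverse transform at `y` is the integral identity `hG` for the translate of `φ` by `y`.
    rw [Real.fourierInv_eq, ← hG _ (hφ.comp_sub y)]
    refine integral_congr_ae (Eventually.of_forall fun k => ?_)
    simp only [IsTest.fourierInv_comp_sub, Circle.smul_def, smul_eq_mul, Finset.mul_sum]
    exact Finset.sum_congr rfl fun a _ => by ring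
  have hball : ∀ n : ℕ, ∀ᵐ k : Plane, ‖k‖ < (n + 1 : ℝ) →
      ∑ a, p a k * l2Fourier (toC (h a)) k = 0 := by
    intro n
    -- On each ball one can divide by the transform of a suitable test function; balls of integer
    -- radius exhaust the plane.
    obtain ⟨φ, hφ, hne⟩ := exists_isTest_fourierInv_ne_zero (R := n + 1) (by positivity)
    filter_upwards [key φ hφ] with k hk hlt
    have : 𝓕⁻ (toC φ) k * ∑ a, p a k * l2Fourier (toC (h a)) k = 0 := by
      rw [Finset.mul_sum, ← (show _ = (0 : ℂ) from hk)]
      exact Finset.sum_congr rfl fun a _ => by ring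
    exact (mul_eq_zero.1 this).resolve_left (hne k hlt)
  filter_upwards [ae_all_iff.2 hball] with k hk
  obtain ⟨n, hn⟩ := exists_nat_gt ‖k‖
  exact hk n (by linarith)

end

section

/-! ### Line coordinates and the Fourier slice theorem -/

/-- The isometry `(p, s) ↦ p ξ^⊥ + s ξ`. -/
def lineIsometry (θ : ℝ) : Plane →ₗᵢ[ℝ] Plane where
  toFun x := x 0 • dirPerp θ + x 1 • dir θ
  map_add' x y := by simp only [PiLp.add_apply, add_smul]; abel
  map_smul' c x := by simp only [PiLp.smul_apply, smul_eq_mul, mul_smul, RingHom.id_apply, smul_add]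
  norm_map' x := by
    simp only [LinearMap.coe_mk, AddHom.coe_mk, EuclideanSpace.norm_eq, Fin.sum_univ_two, dir,
      dirPerp, Real.norm_eq_abs, sq_abs]
    congr 1
    simp
    linear_combination (x 0 ^ 2 + x 1 ^ 2) * Real.sin_sq_add_cos_sq θ

/-- The coordinates `(p, s) ↦ p ξ^⊥ + s ξ` of the plane. -/
def lineCoord (θ : ℝ) : ℝ × ℝ ≃ᵐ Plane :=
  (MeasurableEquiv.finTwoArrow.symm.trans (MeasurableEquiv.toLp 2 (Fin 2 → ℝ))).trans
    ((lineIsometry θ).toLinearIsometryEquiv rfl).toMeasurableEquiv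

theorem measurePreserving_planeCoord : MeasurePreserving
    (MeasurableEquiv.finTwoArrow.symm.trans (MeasurableEquiv.toLp 2 (Fin 2 → ℝ)))
    (volume : Measure (ℝ × ℝ)) (volume : Measure Plane) :=
  ((volume_preserving_finTwoArrow ℝ).symm _).trans
    ((EuclideanSpace.volume_preserving_symm_measurableEquiv_toLp (Fin 2)).symm _)

theorem measurePreserving_lineCoord (θ : ℝ) :
    MeasurePreserving (lineCoord θ) volume volume :=
  measurePreserving_planeCoord.trans
    ((lineIsometry θ).toLinearIsometryEquiv rfl).measurePreserving

theorem norm_dirPerp (θ : ℝ) : ‖dirPerp θ‖ = 1 := by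
  simp [EuclideanSpace.norm_eq, Fin.sum_univ_two, dirPerp]

theorem inner_line (θ p s : ℝ) : inner ℝ (p • dirPerp θ + s • dir θ) (dirPerp θ) = p := by
  simp only [dir, dirPerp, PiLp.inner_apply, Fin.sum_univ_two]
  simp
  linear_combination p * Real.sin_sq_add_cos_sq θ

theorem continuous_dirPerp : Continuous dirPerp := by
  unfold dirPerp; fun_prop

theorem continuous_dir : Continuous dir := by
  unfold dir; fun_prop

theorem abs_dir_le_one (θ : ℝ) (i : Fin 2) : |dir θ i| ≤ 1 := by
  fin_cases i
  · simpa [dir] using Real.abs_cos_le_one θ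
  · simpa [dir] using Real.abs_sin_le_one θ

theorem integrable_comp_lineCoord {E : Type*} [NormedAddCommGroup E] {f : Plane → E} (hf : Integrable f) (θ : ℝ) :
    Integrable (fun z : ℝ × ℝ => f (z.1 • dirPerp θ + z.2 • dir θ))
      ((volume : Measure ℝ).prod volume) :=
  (measurePreserving_lineCoord θ).integrable_comp_of_integrable hf

variable {E : Type*} [NormedAddCommGroup E] [NormedSpace ℝ E]

/-- Integration over the plane is integration over a family of parallel lines. -/
theorem integral_integral_line {f : Plane → E} (hf : Integrable f) (θ : ℝ) :
    ∫ p : ℝ, ∫ s : ℝ, f (p • dirPerp θ + s • dir θ) = ∫ x, f x := by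
  rw [← (measurePreserving_lineCoord θ).integral_comp', Measure.volume_eq_prod,
    ← integral_prod _ (integrable_comp_lineCoord hf θ)]
  rfl

/-- The Fourier slice theorem. -/
theorem fourier_radon {φ : Plane → ℝ} (hφ : Integrable φ) (θ κ : ℝ) :
    𝓕 (fun q : ℝ => (radon φ θ q : ℂ)) κ = 𝓕 (toC φ) (κ • dirPerp θ) := by
  have hi : Integrable (fun x : Plane =>
      Real.fourierChar (-inner ℝ x (κ • dirPerp θ)) • toC φ x) :=
    (Real.fourierIntegral_convergent_iff (κ • dirPerp θ)).2 hφ.ofReal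
  -- The phase at the frequency `κ ξ^⊥` is constant along each line of direction `ξ`.
  rw [Real.fourier_eq, Real.fourier_eq, ← integral_integral_line hi θ]
  refine integral_congr_ae (Eventually.of_forall fun p => ?_)
  simp only [radon, inner_smul_right, inner_line, Circle.smul_def]
  rw [← integral_complex_ofReal, ← integral_smul]
  simp

/-! ### The filtered back projection as a Fourier multiplier -/

/-- The Ram-Lak filter on the slices of a function with Fourier transform `Φ`. -/
def filteredSlice (Φ : Plane → ℂ) (θ p : ℝ) : ℂ :=
  ∫ κ : ℝ, Real.fourierChar (κ * p) • (((2 * Real.pi * |κ| : ℝ) : ℂ) * Φ (κ • dirPerp θ))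

theorem ramLak_radon {φ : Plane → ℝ} (hφ : Integrable φ) (θ p : ℝ) :
    ramLak (radon φ θ) p = (filteredSlice (𝓕 (toC φ)) θ p).re := by
  rw [ramLak, Real.fourierInv_eq, filteredSlice]
  simp only [fourier_radon hφ]
  simp [mul_comm]

/-- Schwartz decay of orders 1 and 3 bounds `(‖k‖ + ‖k‖³) ‖Φ k‖`. The resulting majorant is
integrable along lines through the origin, uniformly in their direction. -/
theorem exists_norm_mul_le (Φ : 𝓢(Plane, ℂ)) :
    ∃ C : ℝ, 0 ≤ C ∧ ∀ k, ‖k‖ * ‖Φ k‖ ≤ C * (1 + ‖k‖ ^ 2)⁻¹ := by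
  obtain ⟨C₁, h1, H1⟩ := Φ.decay 1 0
  obtain ⟨C₃, h3, H3⟩ := Φ.decay 3 0
  refine ⟨C₁ + C₃, by positivity, fun k => ?_⟩
  have a := H1 k
  have b := H3 k
  rw [norm_iteratedFDeriv_zero] at a b
  rw [← div_eq_mul_inv, le_div_iff₀ (by positivity)]
  linarith

theorem exists_abs_mul_slice_le (Φ : 𝓢(Plane, ℂ)) :
    ∃ C : ℝ, 0 ≤ C ∧ ∀ θ κ : ℝ, |κ| * ‖Φ (κ • dirPerp θ)‖ ≤ C * (1 + κ ^ 2)⁻¹ := by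
  obtain ⟨C, hC, H⟩ := exists_norm_mul_le Φ
  refine ⟨C, hC, fun θ κ => ?_⟩
  simpa [norm_smul, norm_dirPerp] using H (κ • dirPerp θ)

theorem continuous_filteredSlice (Φ : 𝓢(Plane, ℂ)) :
    Continuous (fun z : ℝ × ℝ => filteredSlice Φ z.1 z.2) := by
  obtain ⟨C, hC, H⟩ := exists_abs_mul_slice_le Φ
  have hd := continuous_dirPerp
  have hΦ := Φ.continuous
  refine continuous_of_dominated (bound := fun κ => 2 * Real.pi * (C * (1 + κ ^ 2)⁻¹))
    (fun z => Continuous.aestronglyMeasurable (by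
      have := Real.continuous_fourierChar; fun_prop)) (fun z => Eventually.of_forall fun κ => ?_)
    ((integrable_inv_one_add_sq.const_mul C).const_mul _)
    (Eventually.of_forall fun κ => by have := Real.continuous_fourierChar; fun_prop)
  rw [Circle.norm_smul, norm_mul, Complex.norm_real, Real.norm_eq_abs, abs_mul, abs_abs,
    abs_of_pos (by positivity : 0 < 2 * Real.pi), mul_assoc]
  exact mul_le_mul_of_nonneg_left (H _ _) (by positivity)

theorem exists_norm_filteredSlice_le (Φ : 𝓢(Plane, ℂ)) :
    ∃ C : ℝ, ∀ θ p, ‖filteredSlice Φ θ p‖ ≤ C := by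
  obtain ⟨C, hC, H⟩ := exists_abs_mul_slice_le Φ
  refine ⟨∫ κ : ℝ, 2 * Real.pi * (C * (1 + κ ^ 2)⁻¹), fun θ p => ?_⟩
  refine norm_integral_le_of_norm_le
    ((integrable_inv_one_add_sq.const_mul C).const_mul _) (Eventually.of_forall fun κ => ?_)
  rw [Circle.norm_smul, norm_mul, Complex.norm_real, Real.norm_eq_abs, abs_mul, abs_abs,
    abs_of_pos (by positivity : 0 < 2 * Real.pi), mul_assoc]
  exact mul_le_mul_of_nonneg_left (H _ _) (by positivity)

/-! ### The symbol of the filtered back projection -/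

/-- The vector `k^⊥`. -/
def perp (k : Plane) : Fin 2 → ℝ := ![k 1, -k 0]

/-- The Fourier multiplier `k^⊥_i k^⊥_j / |k|²`. -/
def perpSymbol (i j : Fin 2) (k : Plane) : ℝ := perp k i * perp k j / ‖k‖ ^ 2

theorem norm_sq_eq (k : Plane) : ‖k‖ ^ 2 = k 0 ^ 2 + k 1 ^ 2 := by
  simp [EuclideanSpace.norm_sq_eq, Fin.sum_univ_two]

theorem abs_perp_le (k : Plane) (i : Fin 2) : |perp k i| ≤ ‖k‖ := by
  apply abs_le_of_sq_le_sq _ (norm_nonneg k)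
  rw [norm_sq_eq]
  fin_cases i <;> simp [perp] <;> positivity

theorem abs_perpSymbol_le (i j : Fin 2) (k : Plane) : |perpSymbol i j k| ≤ 1 := by
  rw [perpSymbol, abs_div, abs_mul, abs_of_nonneg (sq_nonneg ‖k‖)]
  apply div_le_one_of_le₀ _ (sq_nonneg _)
  rw [sq]
  exact mul_le_mul (abs_perp_le k i) (abs_perp_le k j) (abs_nonneg _) (norm_nonneg _)

theorem measurable_perp (i : Fin 2) : Measurable (fun k => perp k i) := by
  fin_cases i <;> simp [perp] <;> fun_prop

theorem measurable_perpSymbol (i j : Fin 2) : Measurable (perpSymbol i j) :=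
  ((measurable_perp i).mul (measurable_perp j)).div (measurable_norm.pow_const 2)

/-- If `k = r ξ^⊥` then `k^⊥ = r ξ`. Thus the weight `ξ_i ξ_j`, which depends on the direction of
projection, is a function of the frequency alone. -/
theorem perpSymbol_smul_dirPerp {r : ℝ} (hr : r ≠ 0) (θ : ℝ) (i j : Fin 2) :
    perpSymbol i j (r • dirPerp θ) = dir θ i * dir θ j := by
  have hn : ‖r • dirPerp θ‖ ^ 2 = r ^ 2 := by rw [norm_smul, norm_dirPerp]; simp
  rw [perpSymbol, hn]
  fin_cases i <;> fin_cases j <;> simp [perp, dir, dirPerp] <;> field_simp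

theorem memLp_perpSymbol_mul (i j : Fin 2) {f : Plane → ℂ} {p : ℝ≥0∞}
    (hf : MemLp f p (volume : Measure Plane)) :
    MemLp (fun k => (perpSymbol i j k : ℂ) * f k) p (volume : Measure Plane) := by
  refine hf.mono ((Complex.measurable_ofReal.comp
    (measurable_perpSymbol i j)).aestronglyMeasurable.mul hf.1) (Eventually.of_forall fun k => ?_)
  rw [norm_mul, Complex.norm_real, Real.norm_eq_abs]
  exact mul_le_of_le_one_left (norm_nonneg _) (abs_perpSymbol_le i j k)

theorem dirPerp_add_pi (θ : ℝ) : dirPerp (θ + Real.pi) = -dirPerp θ := by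
  ext i; fin_cases i <;> simp [dirPerp]

theorem dir_add_pi (θ : ℝ) : dir (θ + Real.pi) = -dir θ := by
  ext i; fin_cases i <;> simp [dir]

theorem dirPerp_sub_pi_div_two (α : ℝ) :
    dirPerp (α - Real.pi / 2) = !₂[Real.cos α, Real.sin α] := by
  ext i; fin_cases i <;> simp [dirPerp, Real.sin_sub_pi_div_two, Real.cos_sub_pi_div_two]

/-! ### Polar coordinates in frequency space -/

/-- Integration over the plane in polar coordinates. -/
theorem integral_polar (f : Plane → E) :
    ∫ x, f x = ∫ z in Set.Ioi (0 : ℝ) ×ˢ Set.Ioo (-Real.pi) Real.pi,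
      z.1 • f (z.1 • dirPerp (z.2 - Real.pi / 2)) := by
  rw [← measurePreserving_planeCoord.integral_comp', ← integral_comp_polarCoord_symm]
  refine setIntegral_congr_fun (by measurability) fun z _ => ?_
  congr 2
  rw [dirPerp_sub_pi_div_two]
  ext i
  fin_cases i <;> simp [polarCoord]

variable (Φ : 𝓢(Plane, ℂ)) (x : Plane) (i j : Fin 2)

/-- The contribution of the half-line in direction `ξ^⊥` to an inverse Fourier transform. -/
def radialPart (θ : ℝ) : ℂ :=
  ∫ κ in Set.Ioi (0 : ℝ), ((κ * (dir θ i * dir θ j) : ℝ) : ℂ) *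
    Real.fourierChar (inner ℝ (κ • dirPerp θ) x) • Φ (κ • dirPerp θ)

theorem continuous_radialIntegrand : Continuous (fun z : ℝ × ℝ =>
    ((z.1 * (dir z.2 i * dir z.2 j) : ℝ) : ℂ) *
    Real.fourierChar (inner ℝ (z.1 • dirPerp z.2) x) • Φ (z.1 • dirPerp z.2)) := by
  have hd := continuous_dirPerp
  have hd' := continuous_dir
  have hΦ := Φ.continuous
  have := Real.continuous_fourierChar
  fun_prop

theorem exists_norm_radialIntegrand_le : ∃ C : ℝ, 0 ≤ C ∧ ∀ κ θ : ℝ,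
    ‖((κ * (dir θ i * dir θ j) : ℝ) : ℂ) *
      Real.fourierChar (inner ℝ (κ • dirPerp θ) x) • Φ (κ • dirPerp θ)‖
      ≤ C * (1 + κ ^ 2)⁻¹ := by
  obtain ⟨C, hC, H⟩ := exists_abs_mul_slice_le Φ
  refine ⟨C, hC, fun κ θ => le_trans ?_ (H θ κ)⟩
  rw [norm_mul, Circle.norm_smul, Complex.norm_real, Real.norm_eq_abs, abs_mul, abs_mul]
  gcongr
  exact mul_le_of_le_one_right (abs_nonneg _)
    (mul_le_one₀ (abs_dir_le_one θ i) (abs_nonneg _) (abs_dir_le_one θ j))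

theorem integrable_radialIntegrand (θ : ℝ) : Integrable (fun κ : ℝ =>
    ((κ * (dir θ i * dir θ j) : ℝ) : ℂ) *
    Real.fourierChar (inner ℝ (κ • dirPerp θ) x) • Φ (κ • dirPerp θ)) := by
  obtain ⟨C, hC, H⟩ := exists_norm_radialIntegrand_le Φ x i j
  exact (integrable_inv_one_add_sq.const_mul C).mono'
    ((continuous_radialIntegrand Φ x i j).comp
      (Continuous.prodMk_left θ)).aestronglyMeasurable (Eventually.of_forall fun κ => H κ θ)

theorem continuous_radialPart : Continuous (radialPart Φ x i j) := by
  obtain ⟨C, hC, H⟩ := exists_norm_radialIntegrand_le Φ x i j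
  exact continuous_of_dominated (bound := fun κ => C * (1 + κ ^ 2)⁻¹)
    (fun θ => (integrable_radialIntegrand Φ x i j θ).aestronglyMeasurable.restrict)
    (fun θ => Eventually.of_forall fun κ => H κ θ)
    (integrable_inv_one_add_sq.const_mul C).integrableOn
    (Eventually.of_forall fun κ =>
      (continuous_radialIntegrand Φ x i j).comp (Continuous.prodMk_right κ))

theorem periodic_radialPart : Function.Periodic (radialPart Φ x i j) (2 * Real.pi) := by
  intro θ
  have h1 : dirPerp (θ + 2 * Real.pi) = dirPerp θ := by simp [dirPerp]
  have h2 : dir (θ + 2 * Real.pi) = dir θ := by simp [dir]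
  simp only [radialPart, h1, h2]

/-- In polar coordinates the Jacobian supplies the factor `κ` of `radialPart`, and the symbol
becomes `ξ_i ξ_j`. -/
theorem fourierInv_perpSymbol_mul :
    𝓕⁻ (fun k => (perpSymbol i j k : ℂ) * Φ k) x
      = ∫ θ in (0 : ℝ)..(2 * Real.pi), radialPart Φ x i j θ := by
  obtain ⟨C, hC, H⟩ := exists_norm_radialIntegrand_le Φ x i j
  have hint : Integrable (fun z : ℝ × ℝ =>
      ((z.1 * (dir (z.2 - Real.pi / 2) i * dir (z.2 - Real.pi / 2) j) : ℝ) : ℂ) *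
      Real.fourierChar (inner ℝ (z.1 • dirPerp (z.2 - Real.pi / 2)) x) •
        Φ (z.1 • dirPerp (z.2 - Real.pi / 2)))
      ((volume.restrict (Set.Ioi (0 : ℝ))).prod
        (volume.restrict (Set.Ioo (-Real.pi) Real.pi))) := by
    have hb : Integrable (fun z : ℝ × ℝ => C * (1 + z.1 ^ 2)⁻¹ * 1)
        ((volume.restrict (Set.Ioi (0 : ℝ))).prod
          (volume.restrict (Set.Ioo (-Real.pi) Real.pi))) :=
      Integrable.mul_prod (f := fun κ : ℝ => C * (1 + κ ^ 2)⁻¹) (g := fun _ : ℝ => (1 : ℝ))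
        (integrable_inv_one_add_sq.const_mul C).integrableOn (integrable_const _)
    refine hb.mono' ((continuous_radialIntegrand Φ x i j).comp (continuous_fst.prodMk
      (continuous_snd.sub continuous_const))).aestronglyMeasurable
      (Eventually.of_forall fun z => ?_)
    rw [mul_one]
    exact H z.1 (z.2 - Real.pi / 2)
  rw [Real.fourierInv_eq, integral_polar]
  have e1 : ∫ z in Set.Ioi (0 : ℝ) ×ˢ Set.Ioo (-Real.pi) Real.pi,
      z.1 • (Real.fourierChar (inner ℝ (z.1 • dirPerp (z.2 - Real.pi / 2)) x) •
        ((perpSymbol i j (z.1 • dirPerp (z.2 - Real.pi / 2)) : ℂ) *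
          Φ (z.1 • dirPerp (z.2 - Real.pi / 2))))
      = ∫ z in Set.Ioi (0 : ℝ) ×ˢ Set.Ioo (-Real.pi) Real.pi,
        ((z.1 * (dir (z.2 - Real.pi / 2) i * dir (z.2 - Real.pi / 2) j) : ℝ) : ℂ) *
      Real.fourierChar (inner ℝ (z.1 • dirPerp (z.2 - Real.pi / 2)) x) •
        Φ (z.1 • dirPerp (z.2 - Real.pi / 2)) := by
    refine setIntegral_congr_fun (measurableSet_Ioi.prod measurableSet_Ioo) fun z hz => ?_
    simp only [perpSymbol_smul_dirPerp (ne_of_gt hz.1), Circle.smul_def, Complex.real_smul,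
      smul_eq_mul]
    push_cast
    ring
  rw [e1, Measure.volume_eq_prod, ← Measure.prod_restrict, integral_prod_symm _ hint]
  have e2 : ∀ α : ℝ, (∫ r in Set.Ioi (0 : ℝ),
      ((r * (dir (α - Real.pi / 2) i * dir (α - Real.pi / 2) j) : ℝ) : ℂ) *
      Real.fourierChar (inner ℝ (r • dirPerp (α - Real.pi / 2)) x) •
        Φ (r • dirPerp (α - Real.pi / 2))) = radialPart Φ x i j (α - Real.pi / 2) :=
    fun α => rfl
  simp only [e2]
  rw [← integral_Ioc_eq_integral_Ioo, ← intervalIntegral.integral_of_le (by linarith [Real.pi_pos]),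
    intervalIntegral.integral_comp_sub_right (radialPart Φ x i j)]
  -- The quarter turn between `ξ` and `ξ^⊥` shifts the range of angles; it is still one full period.
  have := (periodic_radialPart Φ x i j).intervalIntegral_add_eq (-Real.pi - Real.pi / 2) 0
  rw [zero_add] at this
  rw [← this]
  congr 1
  ring

/-- The frequency line splits at 0. Reflecting `κ < 0` gives the half-line of the direction `θ + π`:
there `ξ^⊥` changes sign, while `ξ_i ξ_j` does not. -/
theorem dir_mul_filteredSlice (θ : ℝ) :
    ((dir θ i * dir θ j : ℝ) : ℂ) * filteredSlice Φ θ (inner ℝ x (dirPerp θ))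
      = 2 * Real.pi * (radialPart Φ x i j θ + radialPart Φ x i j (θ + Real.pi)) := by
  have hint := integrable_radialIntegrand Φ x i j
  have h1 : radialPart Φ x i j (θ + Real.pi) = ∫ κ in Set.Iic (0 : ℝ),
      -(((κ * (dir θ i * dir θ j) : ℝ) : ℂ) *
        Real.fourierChar (inner ℝ (κ • dirPerp θ) x) • Φ (κ • dirPerp θ)) := by
    have h0 := integral_comp_neg_Iic (0 : ℝ) (fun κ : ℝ =>
      ((κ * (dir (θ + Real.pi) i * dir (θ + Real.pi) j) : ℝ) : ℂ) *
        Real.fourierChar (inner ℝ (κ • dirPerp (θ + Real.pi)) x) •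
          Φ (κ • dirPerp (θ + Real.pi)))
    rw [neg_zero] at h0
    rw [radialPart, ← h0]
    refine integral_congr_ae (Eventually.of_forall fun κ => ?_)
    simp [dirPerp_add_pi, dir_add_pi]
  have h2 : ((dir θ i * dir θ j : ℝ) : ℂ) * filteredSlice Φ θ (inner ℝ x (dirPerp θ))
      = ∫ κ : ℝ, 2 * Real.pi * (((|κ| * (dir θ i * dir θ j) : ℝ) : ℂ) *
        Real.fourierChar (inner ℝ (κ • dirPerp θ) x) • Φ (κ • dirPerp θ)) := by
    rw [filteredSlice, ← integral_const_mul]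
    refine integral_congr_ae (Eventually.of_forall fun κ => ?_)
    simp only [real_inner_smul_right, real_inner_comm x, Circle.smul_def, smul_eq_mul]
    push_cast
    ring
  rw [h2, integral_const_mul, h1]
  congr 1
  have h3 : Integrable (fun κ : ℝ => ((|κ| * (dir θ i * dir θ j) : ℝ) : ℂ) *
        Real.fourierChar (inner ℝ (κ • dirPerp θ) x) • Φ (κ • dirPerp θ)) := by
    refine (hint θ).norm.mono' (Continuous.aestronglyMeasurable ?_)
      (Eventually.of_forall fun κ => ?_)
    · have hΦ := Φ.continuous
      have := Real.continuous_fourierChar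
      fun_prop
    · simp
  rw [← integral_add_compl (measurableSet_Ioi (a := (0 : ℝ))) h3, Set.compl_Ioi, radialPart]
  congr 1
  · refine setIntegral_congr_fun measurableSet_Ioi fun κ hκ => ?_
    simp only [abs_of_pos (Set.mem_Ioi.1 hκ)]
  · refine setIntegral_congr_fun measurableSet_Iic fun κ hκ => ?_
    simp only [abs_of_nonpos (Set.mem_Iic.1 hκ)]
    push_cast
    ring

/-- The filtered back projection with weight `ξ_i ξ_j` is a Fourier multiplier. -/
theorem integral_dir_mul_filteredSlice :
    ∫ θ in (0 : ℝ)..(2 * Real.pi),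
      ((dir θ i * dir θ j : ℝ) : ℂ) * filteredSlice Φ θ (inner ℝ x (dirPerp θ))
      = 4 * Real.pi * 𝓕⁻ (fun k => (perpSymbol i j k : ℂ) * Φ k) x := by
  have hc := continuous_radialPart Φ x i j
  simp only [dir_mul_filteredSlice]
  -- The constant `4π` is `2π`, from the angular frequency, times 2, since each half-line is met at
  -- `θ` and again at `θ + π`.
  rw [intervalIntegral.integral_const_mul, intervalIntegral.integral_add
    (hc.intervalIntegrable _ _) ((by fun_prop : Continuous fun θ : ℝ =>
      radialPart Φ x i j (θ + Real.pi)).intervalIntegrable _ _),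
    intervalIntegral.integral_comp_add_right (radialPart Φ x i j), fourierInv_perpSymbol_mul]
  have := (periodic_radialPart Φ x i j).intervalIntegral_add_eq (0 + Real.pi) 0
  rw [zero_add, zero_add] at this
  rw [zero_add, add_comm (2 * Real.pi) Real.pi, this]
  ring

theorem integral_dir_mul_re_filteredSlice :
    1 / (4 * Real.pi) * ∫ θ in (0 : ℝ)..(2 * Real.pi),
      (dir θ i * dir θ j) * (filteredSlice Φ θ (inner ℝ x (dirPerp θ))).re
      = (𝓕⁻ (fun k => (perpSymbol i j k : ℂ) * Φ k) x).re := by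
  have h := congrArg Complex.re (integral_dir_mul_filteredSlice Φ x i j)
  have hc : Continuous fun θ : ℝ =>
      ((dir θ i * dir θ j : ℝ) : ℂ) * filteredSlice Φ θ (inner ℝ x (dirPerp θ)) := by
    simp only [dir_mul_filteredSlice]
    have hc := continuous_radialPart Φ x i j
    fun_prop
  rw [← Complex.reCLM_apply, ← Complex.reCLM.intervalIntegral_comp_comm
    (hc.intervalIntegrable _ _)] at h
  simp only [Complex.reCLM_apply, Complex.re_ofReal_mul] at h
  rw [h, show (4 * Real.pi : ℂ) = ((4 * Real.pi : ℝ) : ℂ) by push_cast; rfl,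
    Complex.re_ofReal_mul]
  field_simp

end

section

theorem l2FourierInv_add {f g : Plane → ℂ} (hf : MemLp f 2 (volume : Measure Plane))
    (hg : MemLp g 2 (volume : Measure Plane)) :
    l2FourierInv (fun x => f x + g x)
      =ᵐ[volume] fun k => l2FourierInv f k + l2FourierInv g k := by
  have h : MemLp (fun x => f x + g x) 2 (volume : Measure Plane) := hf.add hg
  have e : h.toLp = hf.toLp + hg.toLp := rfl
  rw [l2FourierInv_of_memLp h, l2FourierInv_of_memLp hf, l2FourierInv_of_memLp hg, e,
    FourierTransform.fourierInv_add]
  exact Lp.coeFn_add _ _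

theorem l2FourierInv_sum {ι : Type*} (s : Finset ι) {f : ι → Plane → ℂ}
    (hf : ∀ a, MemLp (f a) 2 (volume : Measure Plane)) :
    l2FourierInv (fun x => ∑ a ∈ s, f a x)
      =ᵐ[volume] fun k => ∑ a ∈ s, l2FourierInv (f a) k := by
  classical
  induction s using Finset.induction_on with
  | empty =>
    have h := l2FourierInv_sub (MemLp.zero' (p := 2) (ε := ℂ) (μ := (volume : Measure Plane)))
      MemLp.zero'
    simpa using h
  | insert a s ha ih =>
    simp only [Finset.sum_insert ha]
    filter_upwards [ih, l2FourierInv_add (hf a) (memLp_finsetSum s fun b _ => hf b)] with k h1 h2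
    rw [h2, h1]

theorem l2Fourier_toC {φ : Plane → ℝ} (hφ : IsTest φ) :
    l2Fourier (toC φ) =ᵐ[volume] 𝓕 (toC φ) := by
  simpa [hφ.coe_schwartz] using l2Fourier_schwartz hφ.schwartz

/-! ### The filtered back projection on square-integrable fields -/

/-- The Fourier multiplier operator with symbol `k^⊥_i k^⊥_j / |k|²`. -/
def perpMultiplier (i j : Fin 2) (h : Plane → ℝ) : Plane → ℂ :=
  l2FourierInv fun k => (perpSymbol i j k : ℂ) * l2Fourier (toC h) k

theorem memLp_perpSymbol_mul_l2Fourier (i j : Fin 2) (f : Plane → ℂ) :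
    MemLp (fun k => (perpSymbol i j k : ℂ) * l2Fourier f k) 2 (volume : Measure Plane) :=
  memLp_perpSymbol_mul i j (memLp_l2Fourier f)

theorem memLp_perpMultiplier (i j : Fin 2) (h : Plane → ℝ) :
    MemLp (perpMultiplier i j h) 2 (volume : Measure Plane) :=
  memLp_l2FourierInv _

theorem perpMultiplier_sub (i j : Fin 2) {h₁ h₂ : Plane → ℝ}
    (hh₁ : MemLp h₁ 2 (volume : Measure Plane)) (hh₂ : MemLp h₂ 2 (volume : Measure Plane)) :
    perpMultiplier i j (fun x => h₁ x - h₂ x)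
      =ᵐ[volume] fun x => perpMultiplier i j h₁ x - perpMultiplier i j h₂ x := by
  have e : (fun k => (perpSymbol i j k : ℂ) * l2Fourier (toC fun x => h₁ x - h₂ x) k)
      =ᵐ[volume] fun k => (perpSymbol i j k : ℂ) * l2Fourier (toC h₁) k
        - (perpSymbol i j k : ℂ) * l2Fourier (toC h₂) k := by
    have := l2Fourier_sub (memLp_toC hh₁) (memLp_toC hh₂)
    have e0 : (toC fun x => h₁ x - h₂ x) = fun x => toC h₁ x - toC h₂ x := by ext; simp
    rw [e0]
    filter_upwards [this] with k hk
    rw [hk, mul_sub]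
  rw [perpMultiplier, l2FourierInv_congr e]
  exact l2FourierInv_sub (memLp_perpSymbol_mul_l2Fourier i j _)
    (memLp_perpSymbol_mul_l2Fourier i j _)

/-- Plancherel, with a symbol bounded by 1. This contraction is the continuity behind the extension
to `L²`. -/
theorem eLpNorm_perpMultiplier_le (i j : Fin 2) {h : Plane → ℝ}
    (hh : MemLp h 2 (volume : Measure Plane)) :
    eLpNorm (perpMultiplier i j h) 2 volume ≤ eLpNorm h 2 volume := by
  rw [perpMultiplier, eLpNorm_l2FourierInv (memLp_perpSymbol_mul_l2Fourier i j _)]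
  calc eLpNorm (fun k => (perpSymbol i j k : ℂ) * l2Fourier (toC h) k) 2 volume
      ≤ eLpNorm (l2Fourier (toC h)) 2 volume := by
        refine eLpNorm_mono fun k => ?_
        rw [norm_mul, Complex.norm_real, Real.norm_eq_abs]
        exact mul_le_of_le_one_left (norm_nonneg _) (abs_perpSymbol_le i j k)
    _ = eLpNorm (toC h) 2 volume := eLpNorm_l2Fourier (memLp_toC hh)
    _ = eLpNorm h 2 volume := eLpNorm_congr_norm_ae (Eventually.of_forall fun k => by simp)

theorem memLp_fourier_toC {φ : Plane → ℝ} (hφ : IsTest φ) (p : ℝ≥0∞) :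
    MemLp (𝓕 (toC φ)) p (volume : Measure Plane) := by
  rw [← hφ.coe_schwartz, ← SchwartzMap.fourier_coe]
  exact (𝓕 hφ.schwartz).memLp p

theorem perpMultiplier_eq_fourierInv (i j : Fin 2) {φ : Plane → ℝ} (hφ : IsTest φ) :
    perpMultiplier i j φ
      =ᵐ[volume] 𝓕⁻ (fun k => (perpSymbol i j k : ℂ) * 𝓕 (toC φ) k) := by
  have e : (fun k => (perpSymbol i j k : ℂ) * l2Fourier (toC φ) k)
      =ᵐ[volume] fun k => (perpSymbol i j k : ℂ) * 𝓕 (toC φ) k := by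
    filter_upwards [l2Fourier_toC hφ] with k hk
    rw [hk]
  rw [perpMultiplier, l2FourierInv_congr e]
  exact l2FourierInv_eq_fourierInv (memLp_perpSymbol_mul i j (memLp_fourier_toC hφ 2))
    (memLp_one_iff_integrable.1 (memLp_perpSymbol_mul i j (memLp_fourier_toC hφ 1)))

theorem integrable_sliceIntegrand (Φ : 𝓢(Plane, ℂ)) (θ p : ℝ) : Integrable (fun κ : ℝ =>
    Real.fourierChar (κ * p) • (((2 * Real.pi * |κ| : ℝ) : ℂ) * Φ (κ • dirPerp θ))) := by
  obtain ⟨C, hC, H⟩ := exists_abs_mul_slice_le Φ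
  have hΦ := Φ.continuous
  refine ((integrable_inv_one_add_sq.const_mul C).const_mul (2 * Real.pi)).mono'
    (Continuous.aestronglyMeasurable (by
      have := Real.continuous_fourierChar; fun_prop)) (Eventually.of_forall fun κ => ?_)
  rw [Circle.norm_smul, norm_mul, Complex.norm_real, Real.norm_eq_abs, abs_mul, abs_abs,
    abs_of_pos (by positivity : 0 < 2 * Real.pi), mul_assoc]
  exact mul_le_mul_of_nonneg_left (H _ _) (by positivity)

theorem filteredSlice_sum {ι : Type*} [Fintype ι] (c : ι → ℝ) (Φ : ι → 𝓢(Plane, ℂ)) (θ p : ℝ) :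
    filteredSlice (fun k => ∑ a, (c a : ℂ) * Φ a k) θ p
      = ∑ a, (c a : ℂ) * filteredSlice (Φ a) θ p := by
  simp only [filteredSlice, ← integral_const_mul]
  rw [← integral_finsetSum _ fun a _ => (integrable_sliceIntegrand (Φ a) θ p).const_mul _]
  refine integral_congr_ae (Eventually.of_forall fun κ => ?_)
  simp only [Circle.smul_def, smul_eq_mul, Finset.mul_sum]
  exact Finset.sum_congr rfl fun a _ => by ring

theorem fourier_toC_sum {ι : Type*} [Fintype ι] (c : ι → ℝ) {φ : ι → Plane → ℝ}
    (hφ : ∀ a, IsTest (φ a)) :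
    𝓕 (toC fun x => ∑ a, c a * φ a x)
      = fun k => ∑ a, (c a : ℂ) * (𝓕 (hφ a).schwartz : 𝓢(Plane, ℂ)) k := by
  ext k
  simp only [SchwartzMap.fourier_coe, IsTest.coe_schwartz, Real.fourier_eq,
    ← integral_const_mul]
  rw [← integral_finsetSum]
  · refine integral_congr_ae (Eventually.of_forall fun x => ?_)
    simp only [Circle.smul_def, smul_eq_mul, toC, Complex.ofReal_sum, Complex.ofReal_mul,
      Finset.mul_sum]
    exact Finset.sum_congr rfl fun a _ => by ring
  · intro a _
    exact ((Real.fourierIntegral_convergent_iff k).2 (hφ a).integrable.ofReal).const_mul _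

/-- The weighted sum of the components in the definition of the longitudinal ray transform. -/
theorem sum_dir_mul_eq (F : TensorField) (θ : ℝ) (x : Plane) :
    ∑ i, ∑ j, F x i j * dir θ i * dir θ j
      = ∑ a : Fin 2 × Fin 2, (dir θ a.1 * dir θ a.2) * F x a.1 a.2 := by
  rw [Fintype.sum_prod_type]
  exact Finset.sum_congr rfl fun i _ => Finset.sum_congr rfl fun j _ => by ring

/-- At fixed `θ` the weights do not vary along the line, which reduces the tensor transform to the
scalar one. -/
theorem lrt_eq_radon (F : TensorField) (θ : ℝ) :
    lrt F θ = radon (fun x => ∑ a : Fin 2 × Fin 2, (dir θ a.1 * dir θ a.2) * F x a.1 a.2) θ := by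
  ext p
  simp only [lrt, radon, sum_dir_mul_eq]

/-- The filtered back projection of a smooth field as a Fourier multiplier. -/
theorem fbp_eq {F : TensorField} (hF : ∀ i j, IsTest (fun x => F x i j)) (x : Plane) :
    fbp F x = ∑ a : Fin 2 × Fin 2,
      (𝓕⁻ (fun k => (perpSymbol a.1 a.2 k : ℂ) * 𝓕 (toC fun x => F x a.1 a.2) k) x).re := by
  have h1 : ∀ θ p, ramLak (lrt F θ) p = ∑ a : Fin 2 × Fin 2, (dir θ a.1 * dir θ a.2) *
      (filteredSlice (𝓕 (hF a.1 a.2).schwartz : 𝓢(Plane, ℂ)) θ p).re := by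
    intro θ p
    have ht : IsTest (fun x => ∑ a : Fin 2 × Fin 2, (dir θ a.1 * dir θ a.2) * F x a.1 a.2) :=
      IsTest.sum _ fun a => (hF a.1 a.2).const_mul _
    rw [lrt_eq_radon, ramLak_radon ht.integrable,
      fourier_toC_sum (fun a : Fin 2 × Fin 2 => dir θ a.1 * dir θ a.2) (fun a => hF a.1 a.2),
      filteredSlice_sum, Complex.re_sum]
    simp only [Complex.re_ofReal_mul]
  have hd := continuous_dir
  have hd' := continuous_dirPerp
  rw [fbp, backProj]
  simp only [h1]
  rw [intervalIntegral.integral_finsetSum, Finset.mul_sum]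
  · refine Finset.sum_congr rfl fun a _ => ?_
    rw [integral_dir_mul_re_filteredSlice]
    simp only [SchwartzMap.fourier_coe, IsTest.coe_schwartz]
  · intro a _
    have h2 := (continuous_filteredSlice (𝓕 (hF a.1 a.2).schwartz : 𝓢(Plane, ℂ))).comp
      (by fun_prop : Continuous fun θ : ℝ => (θ, inner ℝ x (dirPerp θ)))
    exact (Continuous.mul (by fun_prop)
      (Complex.continuous_re.comp h2)).intervalIntegrable _ _

/-- `ĝ = f̂_ij k^⊥_i k^⊥_j / |k|²`. -/
def SymbolRel (f : TensorField) (g : Plane → ℝ) : Prop :=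
  ∀ᵐ k : Plane, l2Fourier (toC g) k = ∑ a : Fin 2 × Fin 2,
    (perpSymbol a.1 a.2 k : ℂ) * l2Fourier (toC fun x => f x a.1 a.2) k

theorem SymbolRel.eq_re_sum {f : TensorField} {g : Plane → ℝ}
    (hg : MemLp g 2 (volume : Measure Plane)) (h : SymbolRel f g) :
    ∀ᵐ x : Plane, g x
      = ∑ a : Fin 2 × Fin 2, (perpMultiplier a.1 a.2 (fun x => f x a.1 a.2) x).re := by
  have h1 := l2FourierInv_l2Fourier (memLp_toC hg)
  rw [l2FourierInv_congr h] at h1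
  filter_upwards [h1, l2FourierInv_sum Finset.univ fun a : Fin 2 × Fin 2 =>
    memLp_perpSymbol_mul_l2Fourier a.1 a.2 (toC fun x => f x a.1 a.2)] with x h1 h2
  rw [h1] at h2
  have := congrArg Complex.re h2
  rw [Complex.re_sum] at this
  exact this

/-- By linearity `fbp (F n) - g` is the sum of the multipliers applied to the components of `F n -
f`, and each multiplier is a contraction. -/
theorem SymbolRel.tendsto_fbp {f : TensorField} {g : Plane → ℝ}
    (hf : ∀ i j, MemLp (fun x => f x i j) 2 (volume : Measure Plane))
    (hg : MemLp g 2 (volume : Measure Plane)) (h : SymbolRel f g)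
    (F : ℕ → TensorField) (hF : ∀ n, IsTestTensor (F n))
    (hlim : ∀ i j, Tendsto
      (fun n => eLpNorm (fun x => F n x i j - f x i j) 2 (volume : Measure Plane)) atTop (𝓝 0)) :
    Tendsto (fun n => eLpNorm (fun x => fbp (F n) x - g x) 2 (volume : Measure Plane))
      atTop (𝓝 0) := by
  have hle : ∀ n, eLpNorm (fun x => fbp (F n) x - g x) 2 (volume : Measure Plane)
      ≤ ∑ a : Fin 2 × Fin 2, eLpNorm (fun x => F n x a.1 a.2 - f x a.1 a.2) 2 volume := by
    intro n
    have hT := fun i j => (hF n).1 i j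
    have hm : ∀ a : Fin 2 × Fin 2, MemLp (fun x => F n x a.1 a.2 - f x a.1 a.2) 2
        (volume : Measure Plane) := fun a => ((hT a.1 a.2).memLp 2).sub (hf a.1 a.2)
    have e : (fun x => fbp (F n) x - g x) =ᵐ[volume] ∑ a : Fin 2 × Fin 2, fun x =>
        (perpMultiplier a.1 a.2 (fun x => F n x a.1 a.2 - f x a.1 a.2) x).re := by
      filter_upwards [h.eq_re_sum hg,
        ae_all_iff.2 fun a : Fin 2 × Fin 2 => perpMultiplier_eq_fourierInv a.1 a.2 (hT a.1 a.2),
        ae_all_iff.2 fun a : Fin 2 × Fin 2 => perpMultiplier_sub a.1 a.2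
          ((hT a.1 a.2).memLp 2) (hf a.1 a.2)] with x h1 h2 h3
      rw [fbp_eq hT, h1, Finset.sum_apply, ← Finset.sum_sub_distrib]
      refine Finset.sum_congr rfl fun a _ => ?_
      rw [h3 a, Complex.sub_re, h2 a]
    rw [eLpNorm_congr_ae e]
    refine (eLpNorm_sum_le (fun a _ =>
      (memLp_perpMultiplier a.1 a.2 _).re.aestronglyMeasurable) (by norm_num)).trans
      (Finset.sum_le_sum fun a _ => ?_)
    refine le_trans (eLpNorm_mono fun x => ?_) (eLpNorm_perpMultiplier_le a.1 a.2 (hm a))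
    simpa using Complex.abs_re_le_norm _
  refine tendsto_of_tendsto_of_tendsto_of_le_of_le tendsto_const_nhds ?_ (fun _ => zero_le) hle
  simpa using tendsto_finsetSum (Finset.univ : Finset (Fin 2 × Fin 2))
    fun a _ => hlim a.1 a.2

/-! ### The distributional filtered back projection -/

/-- The contribution of the direction `ξ` to the filtered back projection, tested against a
function with Fourier transform `Φ`. -/
def sliceWeight (Φ : Plane → ℂ) (a : Fin 2 × Fin 2) (θ : ℝ) (x : Plane) : ℝ :=
  dir θ a.1 * dir θ a.2 * (filteredSlice Φ θ (inner ℝ x (dirPerp θ))).re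

theorem continuous_sliceWeight (Φ : 𝓢(Plane, ℂ)) (a : Fin 2 × Fin 2) :
    Continuous (fun z : ℝ × Plane => sliceWeight Φ a z.1 z.2) := by
  have hd := continuous_dir
  have hd' := continuous_dirPerp
  have hψc : Continuous (fun z : ℝ × Plane =>
      (filteredSlice Φ z.1 (inner ℝ z.2 (dirPerp z.1))).re) :=
    Complex.continuous_re.comp ((continuous_filteredSlice Φ).comp
      (by fun_prop : Continuous fun z : ℝ × Plane => (z.1, inner ℝ z.2 (dirPerp z.1))))
  exact Continuous.mul (by fun_prop) hψc

theorem exists_norm_sliceWeight_le (Φ : 𝓢(Plane, ℂ)) :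
    ∃ C, ∀ a θ x, ‖sliceWeight Φ a θ x‖ ≤ C := by
  obtain ⟨C, hC⟩ := exists_norm_filteredSlice_le Φ
  refine ⟨C, fun a θ x => ?_⟩
  rw [sliceWeight, norm_mul, norm_mul]
  calc ‖dir θ a.1‖ * ‖dir θ a.2‖ * ‖(filteredSlice Φ θ (inner ℝ x (dirPerp θ))).re‖
      ≤ 1 * 1 * C := by
        gcongr
        · exact abs_dir_le_one θ a.1
        · exact abs_dir_le_one θ a.2
        · exact (Complex.abs_re_le_norm _).trans (hC _ _)
    _ = C := by ring

/-- The filtered test function depends on `p = ⟨x, ξ^⊥⟩` only, so it enters the line integral as a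
constant, and the integrals over `s` and `p` form one over the plane. -/
theorem ramLakDistr_lrt {f : TensorField} (hf : ∀ i j, Integrable (fun x => f x i j))
    {φ : Plane → ℝ} (hφ : IsTest φ) (θ : ℝ) :
    ramLakDistr (lrt f θ) (radon φ θ)
      = ∫ x : Plane, ∑ a : Fin 2 × Fin 2, f x a.1 a.2 * sliceWeight (𝓕 (toC φ)) a θ x := by
  have hΦ : ((𝓕 hφ.schwartz : 𝓢(Plane, ℂ)) : Plane → ℂ) = 𝓕 (toC φ) := by
    rw [SchwartzMap.fourier_coe, hφ.coe_schwartz]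
  obtain ⟨C, hC⟩ := exists_norm_sliceWeight_le (𝓕 hφ.schwartz : 𝓢(Plane, ℂ))
  have hc := continuous_sliceWeight (𝓕 hφ.schwartz : 𝓢(Plane, ℂ))
  rw [hΦ] at hC hc
  have hi : Integrable (fun x : Plane =>
      ∑ a : Fin 2 × Fin 2, f x a.1 a.2 * sliceWeight (𝓕 (toC φ)) a θ x) :=
    integrable_finsetSum _ fun a _ => (hf a.1 a.2).mul_bdd (c := C)
      ((hc a).comp (Continuous.prodMk_right θ)).aestronglyMeasurable
      (Eventually.of_forall fun x => hC a θ x)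
  rw [← integral_integral_line hi θ, ramLakDistr]
  refine integral_congr_ae (Eventually.of_forall fun p => ?_)
  simp only [sliceWeight, inner_line, ramLak_radon hφ.integrable, lrt, sum_dir_mul_eq]
  -- This needs no integrability, so lines on which the integral of `f` diverges do no harm.
  rw [← integral_mul_const]
  refine integral_congr_ae (Eventually.of_forall fun s => ?_)
  simp only [Finset.sum_mul]
  exact Finset.sum_congr rfl fun a _ => by ring

/-- The weight is bounded and the range of angles finite; this justifies exchanging the integrals
over `θ` and `x`. -/
theorem integrable_mul_sliceWeight {h : Plane → ℝ} (hh : Integrable h) (Φ : 𝓢(Plane, ℂ))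
    (a : Fin 2 × Fin 2) :
    Integrable (fun z : ℝ × Plane => h z.2 * sliceWeight Φ a z.1 z.2)
      ((volume.restrict (Set.Ioc 0 (2 * Real.pi))).prod volume) := by
  obtain ⟨C, hC⟩ := exists_norm_sliceWeight_le Φ
  have hb : Integrable (fun z : ℝ × Plane => h z.2)
      ((volume.restrict (Set.Ioc (0 : ℝ) (2 * Real.pi))).prod volume) := by
    simpa using Integrable.mul_prod (f := fun _ : ℝ => (1 : ℝ))
      (μ := volume.restrict (Set.Ioc (0 : ℝ) (2 * Real.pi))) (integrable_const _) hh
  exact hb.mul_bdd (c := C) (continuous_sliceWeight Φ a).aestronglyMeasurable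
    (Eventually.of_forall fun z => hC a z.1 z.2)

theorem intervalIntegral_integral_swap {F : ℝ → Plane → ℝ} {T : ℝ} (hT : 0 ≤ T)
    (hF : Integrable (fun z : ℝ × Plane => F z.1 z.2)
      ((volume.restrict (Set.Ioc 0 T)).prod volume)) :
    ∫ θ in (0 : ℝ)..T, ∫ x, F θ x = ∫ x, ∫ θ in (0 : ℝ)..T, F θ x := by
  simp only [intervalIntegral.integral_of_le hT]
  exact integral_integral_swap hF

theorem integral_sum_mul_sliceWeight (c : Fin 2 × Fin 2 → ℝ) (Φ : 𝓢(Plane, ℂ)) (x : Plane) :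
    1 / (4 * Real.pi) * ∫ θ in (0 : ℝ)..(2 * Real.pi), ∑ a, c a * sliceWeight Φ a θ x
      = ∑ a, c a * (𝓕⁻ (fun k => (perpSymbol a.1 a.2 k : ℂ) * Φ k) x).re := by
  have hcx : ∀ a, Continuous fun θ : ℝ => sliceWeight Φ a θ x :=
    fun a => Continuous.comp (g := fun z : ℝ × Plane => sliceWeight Φ a z.1 z.2)
      (f := fun θ : ℝ => (θ, x)) (continuous_sliceWeight Φ a) (by fun_prop)
  have hi : ∀ a ∈ Finset.univ, IntervalIntegrable (fun θ => c a * sliceWeight Φ a θ x) volume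
      0 (2 * Real.pi) := fun a _ => ((hcx a).intervalIntegrable _ _).const_mul (c a)
  rw [intervalIntegral.integral_finsetSum hi, Finset.mul_sum]
  refine Finset.sum_congr rfl fun a _ => ?_
  rw [← integral_dir_mul_re_filteredSlice, intervalIntegral.integral_const_mul]
  simp only [sliceWeight]
  ring

/-- The distributional filtered back projection of an integrable field. -/
theorem fbpDistr_eq {f : TensorField} (hf : ∀ i j, Integrable (fun x => f x i j))
    {φ : Plane → ℝ} (hφ : IsTest φ) :
    fbpDistr f φ = ∫ x : Plane, ∑ a : Fin 2 × Fin 2, f x a.1 a.2 *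
      (𝓕⁻ (fun k => (perpSymbol a.1 a.2 k : ℂ) * 𝓕 (toC φ) k) x).re := by
  have hΦ : ((𝓕 hφ.schwartz : 𝓢(Plane, ℂ)) : Plane → ℂ) = 𝓕 (toC φ) := by
    rw [SchwartzMap.fourier_coe, hφ.coe_schwartz]
  rw [fbpDistr, backProjDistr]
  simp only [ramLakDistr_lrt hf hφ]
  rw [← hΦ, intervalIntegral_integral_swap (by positivity)
    (integrable_finsetSum _ fun a _ => integrable_mul_sliceWeight (hf a.1 a.2) _ a),
    ← integral_const_mul]
  simp only [integral_sum_mul_sliceWeight]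

/-- The symbol is real, so Plancherel moves it from `φ` to `f`, where the symbol relation replaces
the sum by `ĝ`. -/
theorem SymbolRel.fbpDistr_eq {f : TensorField} {g : Plane → ℝ}
    (hf : ∀ i j, MemLp (fun x => f x i j) 2 (volume : Measure Plane))
    (hg : MemLp g 2 (volume : Measure Plane)) (h : SymbolRel f g)
    (hf1 : ∀ i j, Integrable (fun x => f x i j)) {φ : Plane → ℝ} (hφ : IsTest φ) :
    fbpDistr f φ = ∫ x : Plane, g x * φ x := by
  have hΦ := fun a : Fin 2 × Fin 2 => memLp_perpSymbol_mul_l2Fourier a.1 a.2 (toC φ)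
  have hi : ∀ a : Fin 2 × Fin 2, Integrable (fun x =>
      (f x a.1 a.2 : ℂ) * perpMultiplier a.1 a.2 φ x) := fun a =>
    (memLp_toC (hf a.1 a.2)).integrable_mul (memLp_perpMultiplier a.1 a.2 φ)
  have h1 : fbpDistr f φ = ∑ a : Fin 2 × Fin 2,
      (∫ x, (f x a.1 a.2 : ℂ) * perpMultiplier a.1 a.2 φ x).re := by
    rw [ScalarFBP.fbpDistr_eq hf1 hφ, ← Complex.re_sum, ← integral_finsetSum _ fun a _ => hi a,
      ← Complex.reCLM_apply, ← Complex.reCLM.integral_comp_comm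
        (integrable_finsetSum _ fun a _ => hi a)]
    refine integral_congr_ae ?_
    filter_upwards [ae_all_iff.2 fun a : Fin 2 × Fin 2 =>
      perpMultiplier_eq_fourierInv a.1 a.2 hφ] with x hx
    simp only [Complex.reCLM_apply, Complex.re_sum, Complex.re_ofReal_mul, hx]
  have h2 : ∀ a : Fin 2 × Fin 2, ∫ x, (f x a.1 a.2 : ℂ) * perpMultiplier a.1 a.2 φ x
      = ∫ k, conj (l2Fourier (toC fun x => f x a.1 a.2) k) *
        ((perpSymbol a.1 a.2 k : ℂ) * l2Fourier (toC φ) k) := by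
    intro a
    have := integral_conj_mul_l2FourierInv (memLp_toC (hf a.1 a.2)) (hΦ a)
    simp only [toC, Complex.conj_ofReal] at this
    exact this
  have h3 : ∀ a : Fin 2 × Fin 2, Integrable (fun k =>
      conj (l2Fourier (toC fun x => f x a.1 a.2) k) *
        ((perpSymbol a.1 a.2 k : ℂ) * l2Fourier (toC φ) k)) := fun a =>
    (memLp_l2Fourier _).star.integrable_mul (hΦ a)
  rw [h1, ← Complex.re_sum]
  simp only [h2]
  rw [← integral_finsetSum _ fun a _ => h3 a]
  have h4 : ∫ k, ∑ a : Fin 2 × Fin 2, conj (l2Fourier (toC fun x => f x a.1 a.2) k) *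
        ((perpSymbol a.1 a.2 k : ℂ) * l2Fourier (toC φ) k)
      = ∫ k, conj (l2Fourier (toC g) k) * l2Fourier (toC φ) k := by
    refine integral_congr_ae ?_
    filter_upwards [h] with k hk
    simp only [hk, map_sum, map_mul, Complex.conj_ofReal, Finset.sum_mul]
    exact Finset.sum_congr rfl fun a _ => by ring
  rw [h4, ← integral_conj_mul_l2FourierInv (memLp_toC hg) (memLp_l2Fourier _)]
  have h5 : ∫ x, conj (toC g x) * l2FourierInv (l2Fourier (toC φ)) x
      = ((∫ x, g x * φ x : ℝ) : ℂ) := by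
    rw [← integral_complex_ofReal]
    refine integral_congr_ae ?_
    filter_upwards [l2FourierInv_l2Fourier (memLp_toC (hφ.memLp 2))] with x hx
    rw [hx]
    simp
  rw [h5, Complex.ofReal_re]

theorem SymbolRel.fbpEq {f : TensorField} {g : Plane → ℝ}
    (hf : ∀ i j, MemLp (fun x => f x i j) 2 (volume : Measure Plane))
    (hg : MemLp g 2 (volume : Measure Plane)) (h : SymbolRel f g) : FBPEq f g where
  memLp := hg
  tendsto F hF hlim := h.tendsto_fbp hf hg F hF hlim
  distr hf1 _ hφ := h.fbpDistr_eq hf hg hf1 hφ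

end

section

/-! ### Symbol relations from weak differential equations -/

theorem pd_comm {φ : Plane → ℝ} (hφ : IsTest φ) (i j : Fin 2) :
    pd i (pd j φ) = pd j (pd i φ) := by
  have hd : ∀ x, DifferentiableAt ℝ (fderiv ℝ φ) x := fun x =>
    ((hφ.1.fderiv_right (m := ∞) (by simp)).differentiable (by simp)) x
  have h : ∀ (i j : Fin 2) x, pd i (pd j φ) x =
      fderiv ℝ (fderiv ℝ φ) x (EuclideanSpace.single i 1) (EuclideanSpace.single j 1) := by
    intro i j x
    have e : pd j φ = fun y => (fderiv ℝ φ y) (EuclideanSpace.single j 1) := rfl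
    rw [pd, e, fderiv_clm_apply (hd x) (differentiableAt_const _)]
    simp
  ext x
  rw [h, h]
  exact (hφ.1.contDiffAt.isSymmSndFDerivAt
    (by simpa using! (WithTop.coe_le_coe.2 le_top :
      ((2 : ℕ∞) : WithTop ℕ∞) ≤ ((⊤ : ℕ∞) : WithTop ℕ∞)))).eq _ _

theorem pd_neg (j : Fin 2) (φ : Plane → ℝ) :
    pd j (fun x => -φ x) = fun x => -pd j φ x := by
  ext x
  simp [pd]

/-- The derivative in the direction with symbol `k^⊥_i`. -/
def pdPerp (i : Fin 2) (φ : Plane → ℝ) : Plane → ℝ :=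
  if i = 0 then pd 1 φ else fun x => -pd 0 φ x

theorem IsTest.pdPerp {φ : Plane → ℝ} (hφ : IsTest φ) (i : Fin 2) : IsTest (pdPerp i φ) := by
  unfold ScalarFBP.pdPerp
  split_ifs
  · exact hφ.pd 1
  · exact (hφ.pd 0).neg

theorem IsTest.fourierInv_pdPerp {φ : Plane → ℝ} (hφ : IsTest φ) (i : Fin 2) (k : Plane) :
    𝓕⁻ (toC (ScalarFBP.pdPerp i φ)) k
      = -(2 * Real.pi * Complex.I * perp k i) * 𝓕⁻ (toC φ) k := by
  fin_cases i
  · simp [ScalarFBP.pdPerp, perp, hφ.fourierInv_pd]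
  · simp [ScalarFBP.pdPerp, perp, hφ.fourierInv_pd, IsTest.fourierInv_neg]

theorem integrable_mul_isTest {h φ : Plane → ℝ} (hh : MemLp h 2 (volume : Measure Plane))
    (hφ : IsTest φ) : Integrable (fun x => h x * φ x) :=
  hh.integrable_mul (hφ.memLp 2)

theorem DivFree.symbol {s : TensorField}
    (hs : ∀ i j, MemLp (fun x => s x i j) 2 (volume : Measure Plane)) (h : DivFree s)
    (i : Fin 2) :
    ∀ᵐ k : Plane, ∑ j, (k j : ℂ) * l2Fourier (toC fun x => s x i j) k = 0 := by
  have key := ae_sum_symbol_mul_l2Fourier_eq_zero (fun j => hs i j) (D := pd)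
    (p := fun j k => -(2 * Real.pi * Complex.I * k j)) (fun j φ hφ => hφ.pd j)
    (fun j φ hφ k => hφ.fourierInv_pd j k) (fun φ hφ => by
      rw [← integral_finsetSum _ fun j _ => integrable_mul_isTest (hs i j) (hφ.pd j)]
      exact h φ hφ i)
  filter_upwards [key] with k hk
  have hne : (-(2 * Real.pi * Complex.I) : ℂ) ≠ 0 := by simp [Real.pi_ne_zero]
  refine (mul_eq_zero.1 (?_ : -(2 * Real.pi * Complex.I) * _ = (0 : ℂ))).resolve_left hne
  rw [Finset.mul_sum, ← hk]
  exact Finset.sum_congr rfl fun j _ => by ring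

/-- Saint-Venant compatibility: `∂^⊥_i ∂^⊥_j (du)_ij = 0`, because `∂^⊥_i ∂_i = 0`. The cancellation
takes place on the test function, since a merely locally integrable `u` need not have a Fourier
transform. -/
theorem sum_integral_mul_pdPerp_pdPerp {u : Plane → Fin 2 → ℝ}
    (hu : LocallyIntegrable u (volume : Measure Plane)) {g : TensorField}
    (hg : IsSymGrad u g) {φ : Plane → ℝ} (hφ : IsTest φ) :
    ∑ a : Fin 2 × Fin 2, ∫ x, g x a.1 a.2 * pdPerp a.1 (pdPerp a.2 φ) x = 0 := by
  have hui : ∀ i, LocallyIntegrable (fun x => u x i) (volume : Measure Plane) := fun i x => by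
    obtain ⟨s, hs, hi⟩ := hu x
    exact ⟨s, hs, Integrable.eval hi i⟩
  -- After reordering derivatives, only `∂₀∂₁∂₁φ` against `u₀` and `∂₀∂₀∂₁φ` against `u₁` occur.
  have hA := ((hφ.pd 1).pd 1).pd 0
  have hB := ((hφ.pd 1).pd 0).pd 0
  have iA := (hui 0).integrable_smul_right_of_hasCompactSupport hA.continuous hA.2
  have iB := (hui 1).integrable_smul_right_of_hasCompactSupport hB.continuous hB.2
  simp only [smul_eq_mul] at iA iB
  have c01 : pd 1 (pd 0 φ) = pd 0 (pd 1 φ) := pd_comm hφ 1 0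
  have c1 : pd 1 (pd 0 (pd 1 φ)) = pd 0 (pd 1 (pd 1 φ)) := pd_comm (hφ.pd 1) 1 0
  have c0 : pd 1 (pd 0 (pd 0 φ)) = pd 0 (pd 0 (pd 1 φ)) := by
    rw [pd_comm (hφ.pd 0) 1 0, c01]
  have h := fun i j => hg _ ((hφ.pdPerp j).pdPerp i) i j
  have h00 := h 0 0
  have h01 := h 0 1
  have h10 := h 1 0
  have h11 := h 1 1
  simp only [Fintype.sum_prod_type, Fin.sum_univ_two, h00, h01, h10, h11]
  simp only [pdPerp, if_true, if_neg (one_ne_zero (α := Fin 2)), pd_neg, neg_neg, c01, c1, c0]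
  have e1 : ∀ x, 1 / 2 * (u x 0 * pd 0 (pd 1 (pd 1 φ)) x + u x 0 * pd 0 (pd 1 (pd 1 φ)) x)
    = u x 0 * pd 0 (pd 1 (pd 1 φ)) x := fun x => by ring
  have e2 : ∀ x, 1 / 2 * (u x 1 * pd 0 (pd 0 (pd 1 φ)) x + u x 1 * pd 0 (pd 0 (pd 1 φ)) x)
    = u x 1 * pd 0 (pd 0 (pd 1 φ)) x := fun x => by ring
  have e3 : ∀ x, 1 / 2 * (u x 0 * -pd 0 (pd 1 (pd 1 φ)) x + u x 1 * -pd 0 (pd 0 (pd 1 φ)) x)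
    = -(1 / 2) * (u x 0 * pd 0 (pd 1 (pd 1 φ)) x)
      + -(1 / 2) * (u x 1 * pd 0 (pd 0 (pd 1 φ)) x) := fun x => by ring
  have e4 : ∀ x, 1 / 2 * (u x 1 * -pd 0 (pd 0 (pd 1 φ)) x + u x 0 * -pd 0 (pd 1 (pd 1 φ)) x)
    = -(1 / 2) * (u x 0 * pd 0 (pd 1 (pd 1 φ)) x)
      + -(1 / 2) * (u x 1 * pd 0 (pd 0 (pd 1 φ)) x) := fun x => by ring
  simp only [e1, e2, e3, e4]
  rw [integral_add (iA.const_mul _) (iB.const_mul _), integral_const_mul, integral_const_mul]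
  ring

theorem IsSymGrad.symbol {u : Plane → Fin 2 → ℝ}
    (hu : LocallyIntegrable u (volume : Measure Plane)) {g : TensorField}
    (hg2 : ∀ i j, MemLp (fun x => g x i j) 2 (volume : Measure Plane)) (hg : IsSymGrad u g) :
    ∀ᵐ k : Plane, ∑ a : Fin 2 × Fin 2, (perpSymbol a.1 a.2 k : ℂ) *
      l2Fourier (toC fun x => g x a.1 a.2) k = 0 := by
  have key := ae_sum_symbol_mul_l2Fourier_eq_zero (fun a : Fin 2 × Fin 2 => hg2 a.1 a.2)
    (D := fun a φ => pdPerp a.1 (pdPerp a.2 φ))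
    (p := fun a k => (2 * Real.pi * Complex.I) ^ 2 * (perp k a.1 * perp k a.2))
    (fun a φ hφ => (hφ.pdPerp a.2).pdPerp a.1)
    (fun a φ hφ k => by
      rw [(hφ.pdPerp a.2).fourierInv_pdPerp, hφ.fourierInv_pdPerp]; ring)
    (fun φ hφ => sum_integral_mul_pdPerp_pdPerp hu hg hφ)
  filter_upwards [key] with k hk
  have hne : (2 * Real.pi * Complex.I : ℂ) ^ 2 ≠ 0 := by simp [Real.pi_ne_zero]
  refine (mul_eq_zero.1 (?_ : (2 * Real.pi * Complex.I) ^ 2 * _ = (0 : ℂ))).resolve_left hne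
  -- With `0⁻¹ = 0` this also holds at the origin, so no frequency has to be excluded.
  have : ∑ a : Fin 2 × Fin 2, (perpSymbol a.1 a.2 k : ℂ) *
      l2Fourier (toC fun x => g x a.1 a.2) k * (2 * Real.pi * Complex.I : ℂ) ^ 2
      = ((‖k‖ ^ 2 : ℝ) : ℂ)⁻¹ * 0 := by
    rw [← hk, Finset.mul_sum]
    refine Finset.sum_congr rfl fun a _ => ?_
    rw [perpSymbol]
    push_cast
    ring
  rw [mul_comm, Finset.sum_mul, this, mul_zero]

/-! ### The trace of the solenoidal part -/

theorem toC_sub (g h : Plane → ℝ) :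
    toC (fun x => g x - h x) = fun x => toC g x - toC h x := by
  ext x; exact Complex.ofReal_sub _ _

theorem ae_norm_sq_ne_zero : ∀ᵐ k : Plane, (k 0 : ℂ) ^ 2 + (k 1 : ℂ) ^ 2 ≠ 0 := by
  have : ∀ᵐ k : Plane, k ≠ 0 := by simp [ae_iff]
  filter_upwards [this] with k hk
  have h := norm_sq_eq k
  have h' : k 0 ^ 2 + k 1 ^ 2 ≠ 0 := by rw [← h]; simpa using hk
  intro h0
  exact h' (Complex.ofReal_injective (by push_cast; exact h0))

theorem sum_perpSymbol_mul (k : Plane) (S : Fin 2 → Fin 2 → ℂ) :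
    ∑ a : Fin 2 × Fin 2, (perpSymbol a.1 a.2 k : ℂ) * S a.1 a.2
      = ((k 1 : ℂ) ^ 2 * S 0 0 - k 0 * k 1 * (S 0 1 + S 1 0) + (k 0 : ℂ) ^ 2 * S 1 1)
        / ((k 0 : ℂ) ^ 2 + (k 1 : ℂ) ^ 2) := by
  simp only [Fintype.sum_prod_type, Fin.sum_univ_two, perpSymbol, norm_sq_eq, perp]
  simp
  ring

theorem l2Fourier_trace {s : TensorField}
    (hs : ∀ i j, MemLp (fun x => s x i j) 2 (volume : Measure Plane)) :
    l2Fourier (toC fun x => (s x).trace) =ᵐ[volume] fun k =>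
      l2Fourier (toC fun x => s x 0 0) k + l2Fourier (toC fun x => s x 1 1) k := by
  have e : (toC fun x => (s x).trace)
      = fun x => toC (fun x => s x 0 0) x + toC (fun x => s x 1 1) x := by
    ext x; simp [Matrix.trace_fin_two]
  rw [e]
  exact l2Fourier_add (memLp_toC (hs 0 0)) (memLp_toC (hs 1 1))

theorem memLp_trace {s : TensorField}
    (hs : ∀ i j, MemLp (fun x => s x i j) 2 (volume : Measure Plane)) :
    MemLp (fun x => (s x).trace) 2 (volume : Measure Plane) := by
  simp only [Matrix.trace_fin_two]
  exact (hs 0 0).add (hs 1 1)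

/-- Since `k^⊥ ⊗ k^⊥ = |k|² Id - k ⊗ k`, contraction with `ŝ` gives `|k|² tr ŝ - k_i k_j ŝ_ij`, and
the last term vanishes for a solenoidal field. -/
theorem DivFree.symbolRel {s : TensorField}
    (hs : ∀ i j, MemLp (fun x => s x i j) 2 (volume : Measure Plane)) (h : DivFree s) :
    SymbolRel s (fun x => (s x).trace) := by
  filter_upwards [h.symbol hs 0, h.symbol hs 1, l2Fourier_trace hs, ae_norm_sq_ne_zero]
    with k h0 h1 ht hne
  rw [ht, sum_perpSymbol_mul k fun i j => l2Fourier (toC fun x => s x i j) k, eq_div_iff hne]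
  simp only [Fin.sum_univ_two] at h0 h1
  linear_combination (k 0 : ℂ) * h0 + (k 1 : ℂ) * h1

theorem IsHelmholtz.symbolRel {f : TensorField} {u : Plane → Fin 2 → ℝ} {s : TensorField}
    (hf : ∀ i j, MemLp (fun x => f x i j) 2 (volume : Measure Plane)) (h : IsHelmholtz f u s) :
    SymbolRel f (fun x => (s x).trace) := by
  have hs := h.l2.1
  have hp : ∀ᵐ k : Plane, ∑ a : Fin 2 × Fin 2, (perpSymbol a.1 a.2 k : ℂ) *
      l2Fourier (fun x => toC (fun x => f x a.1 a.2) x - toC (fun x => s x a.1 a.2) x) k = 0 := by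
    obtain ⟨g, hg⟩ : ∃ g : TensorField, g = fun x => f x - s x := ⟨_, rfl⟩
    have hg' : ∀ x i j, g x i j = f x i j - s x i j := fun x i j => by
      rw [hg]; exact Matrix.sub_apply _ _ _ _
    have hg2 : ∀ i j, MemLp (fun x => g x i j) 2 (volume : Measure Plane) := fun i j => by
      simp only [hg']; exact (hf i j).sub (hs i j)
    have hpot := h.potential
    rw [← hg] at hpot
    have := hpot.symbol h.locallyIntegrable hg2
    simp only [hg', toC_sub] at this
    exact this
  filter_upwards [h.divFree.symbolRel hs, hp, ae_all_iff.2 fun a : Fin 2 × Fin 2 =>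
      l2Fourier_sub (memLp_toC (hf a.1 a.2)) (memLp_toC (hs a.1 a.2))] with k h1 h2 h3
  simp only [h3, mul_sub, Finset.sum_sub_distrib] at h2
  rw [h1, sub_eq_zero.1 h2]

/-! ### Elasticity -/

/-- The symbol relation for an isotropic linear function of a solenoidal field. -/
theorem DivFree.symbolRel_isotropic {s f : TensorField}
    (hs : ∀ i j, MemLp (fun x => s x i j) 2 (volume : Measure Plane)) (h : DivFree s) (a b : ℝ)
    (hf : ∀ᵐ x : Plane, f x = a • s x - (b * (s x).trace) • (1 : Matrix (Fin 2) (Fin 2) ℝ)) :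
    SymbolRel f (fun x => (a - b) * (s x).trace) := by
  have ht := memLp_trace hs
  have hof : ∀ i, l2Fourier (toC fun x => f x i i) =ᵐ[volume] fun k =>
      a * l2Fourier (toC fun x => s x i i) k - b * l2Fourier (toC fun x => (s x).trace) k := by
    intro i
    have e : (toC fun x => f x i i) =ᵐ[volume] fun x =>
        a * toC (fun x => s x i i) x - b * toC (fun x => (s x).trace) x := by
      filter_upwards [hf] with x hx
      have h' : f x i i = a * s x i i - b * (s x).trace := by rw [hx]; simp
      simp only [toC]
      rw [h']
      push_cast
      rfl
    rw [l2Fourier_congr e]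
    filter_upwards [l2Fourier_sub ((memLp_toC (hs i i)).const_mul (a : ℂ))
      ((memLp_toC ht).const_mul (b : ℂ)), l2Fourier_const_mul a (memLp_toC (hs i i)),
      l2Fourier_const_mul b (memLp_toC ht)] with k h1 h2 h3
    rw [h1, h2, h3]
  have hoff : ∀ i j, i ≠ j → l2Fourier (toC fun x => f x i j) =ᵐ[volume] fun k =>
      a * l2Fourier (toC fun x => s x i j) k := by
    intro i j hij
    have e : (toC fun x => f x i j) =ᵐ[volume] fun x => a * toC (fun x => s x i j) x := by
      filter_upwards [hf] with x hx
      have h' : f x i j = a * s x i j := by rw [hx]; simp [hij]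
      simp only [toC]
      rw [h']
      push_cast
      rfl
    rw [l2Fourier_congr e]
    exact l2Fourier_const_mul a (memLp_toC (hs i j))
  have hg : l2Fourier (toC fun x => (a - b) * (s x).trace) =ᵐ[volume] fun k =>
      (a - b) * l2Fourier (toC fun x => (s x).trace) k := by
    have := l2Fourier_const_mul (a - b) (memLp_toC ht)
    have e : (toC fun x => (a - b) * (s x).trace)
      = fun x => (a - b : ℂ) * toC (fun x => (s x).trace) x := by ext x; simp
    rw [e]
    exact this
  filter_upwards [h.symbolRel hs, hof 0, hof 1, hoff 0 1 (by simp), hoff 1 0 (by simp), hg,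
    ae_norm_sq_ne_zero] with k h1 h00 h11 h01 h10 hg hne
  rw [hg, sum_perpSymbol_mul k fun i j => l2Fourier (toC fun x => f x i j) k, h00, h11, h01, h10,
    eq_div_iff hne]
  rw [sum_perpSymbol_mul k fun i j => l2Fourier (toC fun x => s x i j) k, eq_div_iff hne] at h1
  -- The symbol has trace `|k^⊥|² / |k|² = 1`, so the isotropic term contributes exactly `-b` times
  -- the trace.
  linear_combination (a : ℂ) * h1

/-! ### Hooke's law in the plane -/

theorem stress_apply {E ν : ℝ} {ε : TensorField3} {x : Plane} (hsymm : (ε x).IsSymm)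
    (i j : Fin 3) :
    stress E ν ε x i j = E / (1 + ν) * (ν / (1 - 2 * ν) *
      ((ε x 0 0 + ε x 1 1 + ε x 2 2) * kron i j) + ε x i j) := by
  have h10 := hsymm.apply 0 1
  have h20 := hsymm.apply 0 2
  have h21 := hsymm.apply 1 2
  fin_cases i <;> fin_cases j <;>
    simp [stress, stiffness, kron, Fin.sum_univ_three, h10, h20, h21] <;> ring

theorem memLp_stress (E ν : ℝ) {ε : TensorField3}
    (h : ∀ i j, MemLp (fun x => ε x i j) 2 (volume : Measure Plane)) (i j : Fin 3) :
    MemLp (fun x => stress E ν ε x i j) 2 (volume : Measure Plane) := by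
  change MemLp (fun x => ∑ k, ∑ l, stiffness E ν i j k l * ε x k l) 2 volume
  exact memLp_finsetSum _ fun k _ => memLp_finsetSum _ fun l _ => (h k l).const_mul _

/-- Vanishing traction admits test functions that do not vanish on `∂Ω`. The stress is zero outside
`Ω`, so no surface term arises on extending it. -/
theorem IsStrainField.divFree {Ω : Set Plane} {ε : TensorField3} {E ν : ℝ}
    (hε : IsStrainField Ω ε) (h : TractionFree Ω (inPlane (stress E ν ε))) :
    DivFree (inPlane (stress E ν ε)) := by
  intro φ hφ i
  rw [← h φ hφ i, traction]
  refine (setIntegral_eq_integral_of_forall_compl_eq_zero fun x hx => ?_).symm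
  simp [inPlane, stress, hε.zero_outside x hx]

/-- Hooke's law in plane stress. -/
theorem inPlane_eq_of_planeStress {E ν : ℝ} (hE : E ≠ 0) (h1 : 1 + ν ≠ 0) (h2 : 1 - 2 * ν ≠ 0)
    {ε : TensorField3} {x : Plane} (hsymm : (ε x).IsSymm) (h : stress E ν ε x 2 2 = 0) :
    inPlane ε x = ((1 + ν) / E) • inPlane (stress E ν ε) x
      - (ν / E * (inPlane (stress E ν ε) x).trace) • (1 : Matrix (Fin 2) (Fin 2) ℝ) := by
  have hs := stress_apply (E := E) (ν := ν) hsymm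
  obtain ⟨t, ht⟩ : ∃ t, t = ν / (1 - 2 * ν) := ⟨_, rfl⟩
  have ht' : t * (1 - 2 * ν) = ν := by rw [ht, div_mul_cancel₀ _ h2]
  rw [← ht] at hs
  rw [hs] at h
  -- The condition `σ₃₃ = 0` becomes `t tr ε + ε₃₃ = 0`, which eliminates the out-of-plane strain.
  have h' := (mul_eq_zero.1 h).resolve_left (div_ne_zero hE h1)
  simp only [kron, if_true, mul_one] at h'
  ext i j
  fin_cases i <;> fin_cases j <;>
    simp [inPlane, Matrix.trace_fin_two, hs, kron] <;> field_simp
  · linear_combination -(ε x 0 0 + ε x 1 1 + ε x 2 2) * ht' - ν * h'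
  · linear_combination -(ε x 0 0 + ε x 1 1 + ε x 2 2) * ht' - ν * h'

/-- Hooke's law in plane strain. -/
theorem inPlane_eq_of_planeStrain {E ν : ℝ} (hE : E ≠ 0) (h1 : 1 + ν ≠ 0) (h2 : 1 - 2 * ν ≠ 0)
    {ε : TensorField3} {x : Plane} (hsymm : (ε x).IsSymm) (h : ε x 2 2 = 0) :
    inPlane ε x = ((1 + ν) / E) • inPlane (stress E ν ε) x
      - ((1 + ν) * ν / E * (inPlane (stress E ν ε) x).trace) •
        (1 : Matrix (Fin 2) (Fin 2) ℝ) := by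
  have hs := stress_apply (E := E) (ν := ν) hsymm
  obtain ⟨t, ht⟩ : ∃ t, t = ν / (1 - 2 * ν) := ⟨_, rfl⟩
  have ht' : t * (1 - 2 * ν) = ν := by rw [ht, div_mul_cancel₀ _ h2]
  rw [← ht] at hs
  ext i j
  fin_cases i <;> fin_cases j <;>
    simp [inPlane, Matrix.trace_fin_two, hs, kron, h] <;> field_simp
  · linear_combination -(ε x 0 0 + ε x 1 1) * ht'
  · linear_combination -(ε x 0 0 + ε x 1 1) * ht'

theorem fbpEq_of_tractionFree {E ν : ℝ} (hE : E ≠ 0) (h1 : 1 + ν ≠ 0) (h2 : 1 - 2 * ν ≠ 0)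
    {Ω : Set Plane} {ε : TensorField3} (hε : IsStrainField Ω ε)
    (ht : TractionFree Ω (inPlane (stress E ν ε))) :
    (PlaneStress (stress E ν ε) →
      FBPEq (inPlane ε) (fun x => 1 / E * (inPlane (stress E ν ε) x).trace)) ∧
    (PlaneStrain ε →
      FBPEq (inPlane ε) (fun x => (1 - ν ^ 2) / E * (inPlane (stress E ν ε) x).trace)) := by
  have hf : ∀ i j, MemLp (fun x => inPlane ε x i j) 2 (volume : Measure Plane) :=
    fun i j => hε.l2 i.castSucc j.castSucc
  have hs : ∀ i j, MemLp (fun x => inPlane (stress E ν ε) x i j) 2 (volume : Measure Plane) :=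
    fun i j => memLp_stress E ν hε.l2 i.castSucc j.castSucc
  have hg := fun c : ℝ => (memLp_trace hs).const_mul c
  constructor
  · intro h
    have e : 1 / E = (1 + ν) / E - ν / E := by field_simp; ring
    rw [e]
    refine ((hε.divFree ht).symbolRel_isotropic hs _ _ ?_).fbpEq hf (hg _)
    filter_upwards [h, hε.symm] with x hx hx'
    exact inPlane_eq_of_planeStress hE h1 h2 hx' (hx 2)
  · intro h
    have e : (1 - ν ^ 2) / E = (1 + ν) / E - (1 + ν) * ν / E := by field_simp; ring
    rw [e]
    refine ((hε.divFree ht).symbolRel_isotropic hs _ _ ?_).fbpEq hf (hg _)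
    filter_upwards [h, hε.symm] with x hx hx'
    exact inPlane_eq_of_planeStrain hE h1 h2 hx' (hx 2)

end

section

/-! ### Existence of the Helmholtz decomposition -/

theorem memLp_real_mul {m : Plane → ℝ} (hm : Measurable m) {C : ℝ} (hC : ∀ k, |m k| ≤ C)
    {f : Plane → ℂ} (hf : MemLp f 2 (volume : Measure Plane)) :
    MemLp (fun k => (m k : ℂ) * f k) 2 (volume : Measure Plane) := by
  refine (hf.const_mul (C : ℂ)).mono
    ((Complex.measurable_ofReal.comp hm).aestronglyMeasurable.mul hf.1)
    (Eventually.of_forall fun k => ?_)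
  rw [norm_mul, norm_mul, Complex.norm_real, Complex.norm_real, Real.norm_eq_abs,
    Real.norm_eq_abs]
  exact mul_le_mul_of_nonneg_right ((hC k).trans (le_abs_self C)) (norm_nonneg _)

theorem integral_re_mul {F : Plane → ℂ} {φ : Plane → ℝ}
    (h : Integrable (fun x => toC φ x * F x)) :
    ∫ x, (F x).re * φ x = (∫ x, toC φ x * F x).re := by
  rw [← Complex.reCLM_apply, ← Complex.reCLM.integral_comp_comm h]
  refine integral_congr_ae (Eventually.of_forall fun x => ?_)
  simp [mul_comm]

theorem IsTest.integral_re_l2FourierInv_mul {φ : Plane → ℝ} (hφ : IsTest φ) {G : Plane → ℂ}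
    (hG : MemLp G 2 (volume : Measure Plane)) :
    ∫ x, (l2FourierInv G x).re * φ x = (∫ k, 𝓕⁻ (toC φ) k * G k).re := by
  rw [integral_re_mul ((memLp_toC (hφ.memLp 2)).integrable_mul (memLp_l2FourierInv G)),
    hφ.integral_mul_complex (memLp_l2FourierInv G)]
  congr 1
  refine integral_congr_ae ?_
  filter_upwards [l2Fourier_l2FourierInv hG] with k hk
  rw [hk]

/-! ### Functions whose Fourier transform is singular at the origin -/

theorem norm_fourierChar_sub_one_le (t : ℝ) :
    ‖(Real.fourierChar t : ℂ) - 1‖ ≤ 2 * Real.pi * |t| := by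
  have := Real.norm_exp_I_mul_ofReal_sub_one_le (x := 2 * Real.pi * t)
  rw [Real.fourierChar_apply, mul_comm _ Complex.I]
  refine this.trans (le_of_eq ?_)
  rw [Real.norm_eq_abs, abs_mul, abs_of_pos (by positivity : 0 < 2 * Real.pi)]

variable {V : Plane → ℂ}

/-- Differentiating the test function yields a factor `k_j`, which compensates the possible
singularity of `V` at the origin. -/
theorem integrable_mul_fourierInv_pd (hV : AEStronglyMeasurable V (volume : Measure Plane))
    (hV2 : MemLp (fun k => (‖k‖ : ℂ) * V k) 2 (volume : Measure Plane))
    {φ : Plane → ℝ} (hφ : IsTest φ) (j : Fin 2) :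
    Integrable (fun k => 𝓕⁻ (toC (pd j φ)) k * V k) := by
  have h := (hφ.memLp_fourierInv.integrable_mul hV2).const_mul (2 * Real.pi : ℂ)
  refine h.mono ((hφ.pd j).memLp_fourierInv.1.mul hV) (Eventually.of_forall fun k => ?_)
  have hk : |k j| ≤ ‖k‖ := PiLp.norm_apply_le k j
  have e : ‖𝓕⁻ (toC (pd j φ)) k‖ = 2 * Real.pi * |k j| * ‖𝓕⁻ (toC φ) k‖ := by
    rw [hφ.fourierInv_pd]
    simp [abs_of_pos Real.pi_pos]
  rw [norm_mul, e]
  simp only [Pi.mul_apply, norm_mul, Complex.norm_real, norm_norm, Real.norm_of_nonneg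
    Real.pi_pos.le, Complex.norm_ofNat]
  calc 2 * Real.pi * |k j| * ‖𝓕⁻ (toC φ) k‖ * ‖V k‖
      ≤ 2 * Real.pi * ‖k‖ * ‖𝓕⁻ (toC φ) k‖ * ‖V k‖ := by gcongr
    _ = 2 * Real.pi * (‖𝓕⁻ (toC φ) k‖ * (‖k‖ * ‖V k‖)) := by ring

/-- The low-frequency part of the inverse Fourier transform, renormalised at the origin. -/
def lowFreq (V : Plane → ℂ) (x : Plane) : ℂ :=
  ∫ k, V k * (Real.fourierChar (inner ℝ k x) - 1)

/-- Subtracting 1 from the character gains a factor `‖k‖`, at the price of linear growth in `x`. -/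
theorem norm_lowFreq_integrand_le (V : Plane → ℂ) (x k : Plane) :
    ‖V k * (Real.fourierChar (inner ℝ k x) - 1)‖ ≤ 2 * Real.pi * ‖x‖ * ‖(‖k‖ : ℂ) * V k‖ := by
  rw [norm_mul, norm_mul, Complex.norm_real, norm_norm]
  calc ‖V k‖ * ‖(Real.fourierChar (inner ℝ k x) : ℂ) - 1‖
      ≤ ‖V k‖ * (2 * Real.pi * (‖k‖ * ‖x‖)) := by
        gcongr
        exact (norm_fourierChar_sub_one_le _).trans (by
          gcongr; exact abs_real_inner_le_norm k x)
    _ = 2 * Real.pi * ‖x‖ * (‖k‖ * ‖V k‖) := by ring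

theorem aestronglyMeasurable_lowFreq_integrand
    (hV : AEStronglyMeasurable V (volume : Measure Plane)) :
    AEStronglyMeasurable (fun z : Plane × Plane =>
      V z.2 * (Real.fourierChar (inner ℝ z.2 z.1) - 1)) (volume.prod volume) := by
  refine hV.comp_snd.mul (Continuous.aestronglyMeasurable ?_)
  have := Real.continuous_fourierChar
  fun_prop

theorem locallyIntegrable_lowFreq (hV : AEStronglyMeasurable V (volume : Measure Plane))
    (hV1 : Integrable (fun k => (‖k‖ : ℂ) * V k)) : LocallyIntegrable (lowFreq V) := by
  have hc : Continuous fun x : Plane =>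
      2 * Real.pi * ‖x‖ * ∫ k : Plane, ‖(‖k‖ : ℂ) * V k‖ := by fun_prop
  refine hc.locallyIntegrable.mono
    (aestronglyMeasurable_lowFreq_integrand hV).integral_prod_right'
    (Eventually.of_forall fun x => ?_)
  rw [lowFreq, ← integral_const_mul]
  exact (norm_integral_le_of_norm_le (hV1.norm.const_mul _)
    (Eventually.of_forall fun k => norm_lowFreq_integrand_le V x k)).trans (le_abs_self _)

/-- The renormalising term is constant in `x` and pairs to zero with a test function of mean zero,
in particular with a derivative. -/
theorem integral_mul_lowFreq (hV : AEStronglyMeasurable V (volume : Measure Plane))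
    (hV1 : Integrable (fun k => (‖k‖ : ℂ) * V k)) {φ : Plane → ℝ} (hφ : IsTest φ)
    (h0 : ∫ x, toC φ x = 0) :
    ∫ x, toC φ x * lowFreq V x = ∫ k, 𝓕⁻ (toC φ) k * V k := by
  have hint : Integrable (fun z : Plane × Plane =>
      toC φ z.1 * (V z.2 * (Real.fourierChar (inner ℝ z.2 z.1) - 1))) (volume.prod volume) := by
    have hx : Integrable (fun x : Plane => ‖x‖ * φ x) :=
      Continuous.integrable_of_hasCompactSupport (by have := hφ.continuous; fun_prop)
        hφ.2.mul_left
    refine ((hx.norm.mul_prod hV1.norm).const_mul (2 * Real.pi)).mono'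
      ((hφ.contDiff_toC.continuous.comp continuous_fst).aestronglyMeasurable.mul
        (aestronglyMeasurable_lowFreq_integrand hV)) (Eventually.of_forall fun z => ?_)
    rw [norm_mul]
    calc ‖toC φ z.1‖ * ‖V z.2 * (Real.fourierChar (inner ℝ z.2 z.1) - 1)‖
        ≤ ‖toC φ z.1‖ * (2 * Real.pi * ‖z.1‖ * ‖(‖z.2‖ : ℂ) * V z.2‖) := by
          gcongr
          exact norm_lowFreq_integrand_le V z.1 z.2
      _ = 2 * Real.pi * (‖‖z.1‖ * φ z.1‖ * ‖(‖z.2‖ : ℂ) * V z.2‖) := by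
          rw [norm_mul (‖z.1‖), norm_norm, Complex.norm_real]; ring
  simp only [lowFreq, ← integral_const_mul]
  rw [integral_integral_swap (f := fun x k =>
    toC φ x * (V k * (Real.fourierChar (inner ℝ k x) - 1))) hint]
  refine integral_congr_ae (Eventually.of_forall fun k => ?_)
  have hφi : Integrable (toC φ) := hφ.integrable.ofReal
  have hei : Integrable (fun x : Plane => Real.fourierChar (inner ℝ x k) • toC φ x) := by
    have := (Real.fourierIntegral_convergent_iff (-k)).2 hφi
    simpa using this
  calc ∫ x, toC φ x * (V k * (Real.fourierChar (inner ℝ k x) - 1))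
      = ∫ x, (V k * (Real.fourierChar (inner ℝ x k) • toC φ x) - V k * toC φ x) := by
        refine integral_congr_ae (Eventually.of_forall fun x => ?_)
        simp only [Circle.smul_def, smul_eq_mul, real_inner_comm x k]
        ring
    _ = 𝓕⁻ (toC φ) k * V k := by
        rw [integral_sub (hei.const_mul _) (hφi.const_mul _), integral_const_mul,
          integral_const_mul, h0, Real.fourierInv_eq]
        ring

/-- Functions with a square-integrable gradient can be prescribed by their Fourier transform. -/
theorem exists_locallyIntegrable_primitive
    (hV : AEStronglyMeasurable V (volume : Measure Plane))
    (hV2 : MemLp (fun k => (‖k‖ : ℂ) * V k) 2 (volume : Measure Plane)) :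
    ∃ v : Plane → ℂ, LocallyIntegrable v ∧ ∀ φ, IsTest φ → ∀ j,
      ∫ x, toC (pd j φ) x * v x = ∫ k, 𝓕⁻ (toC (pd j φ)) k * V k := by
  -- Inside the unit ball `‖k‖ V` is square-integrable on a set of finite measure, hence integrable;
  -- outside, `‖V‖ ≤ ‖k‖ ‖V‖` puts `V` itself in `L²`.
  set B : Set Plane := Metric.ball 0 1 with hB
  have hBm : MeasurableSet B := measurableSet_ball
  have hlow : Integrable (fun k => (‖k‖ : ℂ) * B.indicator V k) := by
    have e : (fun k => (‖k‖ : ℂ) * B.indicator V k)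
        = B.indicator fun k => (‖k‖ : ℂ) * V k := by
      ext k; by_cases hk : k ∈ B <;> simp [hk]
    rw [e, integrable_indicator_iff hBm]
    have : IsFiniteMeasure ((volume : Measure Plane).restrict B) :=
      ⟨by simpa using measure_ball_lt_top⟩
    exact (hV2.restrict B).integrable (by norm_num)
  have hhigh : MemLp (Bᶜ.indicator V) 2 (volume : Measure Plane) := by
    refine hV2.mono (hV.indicator hBm.compl) (Eventually.of_forall fun k => ?_)
    by_cases hk : k ∈ B
    · rw [Set.indicator_of_notMem (by simpa using hk), norm_zero]
      exact norm_nonneg _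
    · have h1 : 1 ≤ ‖k‖ := by simpa [hB] using hk
      rw [Set.indicator_of_mem (by simpa using hk), norm_mul, Complex.norm_real, norm_norm]
      exact le_mul_of_one_le_left (norm_nonneg _) h1
  have hlm := hV.indicator hBm
  have hL := locallyIntegrable_lowFreq hlm hlow
  have hH := locallyIntegrable_of_memLp (memLp_l2FourierInv (Bᶜ.indicator V))
  refine ⟨fun x => lowFreq (B.indicator V) x + l2FourierInv (Bᶜ.indicator V) x, hL.add hH,
    fun φ hφ j => ?_⟩
  have hχ := hφ.pd j
  -- The mean is the transform at `k = 0`, where the factor `k_j` vanishes.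
  have h0 : ∫ x, toC (pd j φ) x = 0 := by
    have := hφ.fourierInv_pd j 0
    rw [Real.fourierInv_eq] at this
    simpa using this
  have i1 := hL.integrable_smul_left_of_hasCompactSupport hχ.contDiff_toC.continuous
    hχ.hasCompactSupport_toC
  have i2 := hH.integrable_smul_left_of_hasCompactSupport hχ.contDiff_toC.continuous
    hχ.hasCompactSupport_toC
  have hV' := integrable_mul_fourierInv_pd hV hV2 hφ j
  have e3 : ∫ x, toC (pd j φ) x * l2FourierInv (Bᶜ.indicator V) x
      = ∫ k, 𝓕⁻ (toC (pd j φ)) k * Bᶜ.indicator V k := by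
    rw [hχ.integral_mul_complex (memLp_l2FourierInv _)]
    refine integral_congr_ae ?_
    filter_upwards [l2Fourier_l2FourierInv hhigh] with k hk
    rw [hk]
  simp only [smul_eq_mul] at i1 i2
  simp only [mul_add]
  rw [integral_add i1 i2, integral_mul_lowFreq hlm hlow hχ h0, e3]
  have e4 : ∀ S : Set Plane, (fun k => 𝓕⁻ (toC (pd j φ)) k * S.indicator V k)
      = S.indicator fun k => 𝓕⁻ (toC (pd j φ)) k * V k := by
    intro S; ext k; by_cases hk : k ∈ S <;> simp [hk]
  rw [e4, e4, integral_indicator hBm, integral_indicator hBm.compl,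
    integral_add_compl hBm hV']

/-- The coefficients of the Fourier transform of the potential in the Helmholtz decomposition. -/
def potCoeff (i : Fin 2) (a : Fin 2 × Fin 2) (k : Plane) : ℝ :=
  (if i = a.1 then 2 * k a.2 / ‖k‖ ^ 2 else 0) - k i * k a.1 * k a.2 / ‖k‖ ^ 4

theorem measurable_potCoeff (i : Fin 2) (a : Fin 2 × Fin 2) : Measurable (potCoeff i a) := by
  unfold potCoeff
  split_ifs <;> fun_prop

/-- The coefficients are homogeneous of degree -1. This bound is what places `‖k‖ û` in `L²`. -/
theorem abs_norm_mul_potCoeff_le (i : Fin 2) (a : Fin 2 × Fin 2) (k : Plane) :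
    |‖k‖ * potCoeff i a k| ≤ 3 := by
  have hk : ∀ j, |k j| ≤ ‖k‖ := fun j => PiLp.norm_apply_le k j
  rcases (norm_nonneg k).eq_or_lt with h0 | hpos
  · simp [← h0]
  have h1 : |‖k‖ * if i = a.1 then 2 * k a.2 / ‖k‖ ^ 2 else 0| ≤ 2 := by
    split_ifs
    · rw [abs_mul, abs_div, abs_mul, abs_of_pos hpos, abs_of_pos (pow_pos hpos 2), abs_two,
        mul_div_assoc', div_le_iff₀ (pow_pos hpos 2)]
      nlinarith [hk a.2]
    · simp
  have h2 : |‖k‖ * (k i * k a.1 * k a.2 / ‖k‖ ^ 4)| ≤ 1 := by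
    rw [abs_mul, abs_div, abs_mul, abs_mul, abs_of_pos hpos, abs_of_pos (pow_pos hpos 4),
      mul_div_assoc', div_le_iff₀ (pow_pos hpos 4)]
    calc ‖k‖ * (|k i| * |k a.1| * |k a.2|) ≤ ‖k‖ * (‖k‖ * ‖k‖ * ‖k‖) := by
          gcongr
          · exact hk i
          · exact hk a.1
          · exact hk a.2
      _ = 1 * ‖k‖ ^ 4 := by ring
  rw [potCoeff, mul_sub]
  exact (abs_sub _ _).trans (by linarith)

/-- The symbol identity behind the Helmholtz decomposition. -/
theorem potCoeff_identity {k : Plane} (hk : (k 0 : ℂ) ^ 2 + (k 1 : ℂ) ^ 2 ≠ 0)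
    {F : Fin 2 → Fin 2 → ℂ} (hF : F 1 0 = F 0 1) (i j : Fin 2) :
    1 / 2 * (k j * ∑ a : Fin 2 × Fin 2, (potCoeff i a k : ℂ) * F a.1 a.2
      + k i * ∑ a : Fin 2 × Fin 2, (potCoeff j a k : ℂ) * F a.1 a.2)
    = F i j - perpSymbol i j k * ∑ a : Fin 2 × Fin 2, (perpSymbol a.1 a.2 k : ℂ) * F a.1 a.2 := by
  have h4 : ‖k‖ ^ 4 = (k 0 ^ 2 + k 1 ^ 2) ^ 2 := by rw [← norm_sq_eq]; ring
  simp only [Fintype.sum_prod_type, Fin.sum_univ_two, potCoeff, perpSymbol, h4, norm_sq_eq, perp]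
  fin_cases i <;> fin_cases j <;> simp [hF] <;> field_simp <;> ring

/-- At each `k ≠ 0`, symmetric matrices split orthogonally into multiples of `k^⊥ ⊗ k^⊥` and
symmetrised products of `k` with a vector. -/
theorem exists_isHelmholtz {f : TensorField} (hf : IsL2SymTensor f) :
    ∃ (u : Plane → Fin 2 → ℝ) (s : TensorField), IsHelmholtz f u s := by
  obtain ⟨hf2, hsymm⟩ := hf
  set fh : Fin 2 × Fin 2 → Plane → ℂ := fun a => l2Fourier (toC fun x => f x a.1 a.2) with hfh
  have hfhm : ∀ a, MemLp (fh a) 2 (volume : Measure Plane) := fun a => memLp_l2Fourier _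
  set T : Plane → ℂ := fun k => ∑ a, (perpSymbol a.1 a.2 k : ℂ) * fh a k with hT
  have hTm : MemLp T 2 (volume : Measure Plane) :=
    memLp_finsetSum _ fun a _ => memLp_perpSymbol_mul a.1 a.2 (hfhm a)
  -- The orthogonal projection of `f̂` onto the line spanned by `k^⊥ ⊗ k^⊥`.
  set S : Fin 2 → Fin 2 → Plane → ℂ := fun i j k => (perpSymbol i j k : ℂ) * T k with hS
  have hSm : ∀ i j, MemLp (S i j) 2 (volume : Measure Plane) :=
    fun i j => memLp_perpSymbol_mul i j hTm
  -- Real parts suffice: the equations are real and linear, and the test functions are real.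
  set s : TensorField := fun x => Matrix.of fun i j => (l2FourierInv (S i j) x).re with hs
  have hsij : ∀ x i j, s x i j = (l2FourierInv (S i j) x).re := fun x i j => rfl
  have hs2 : ∀ i j, MemLp (fun x => s x i j) 2 (volume : Measure Plane) :=
    fun i j => (memLp_l2FourierInv (S i j)).re
  -- Contracting `πi (k_i û_j + k_j û_i) = f̂_ij - ŝ_ij` with `k_j`, where `ŝ_ij k_j = 0`, and
  -- solving for `û` gives `2πi û = 2 f̂k / |k|² - (k · f̂k) k / |k|⁴`.
  set V : Fin 2 → Plane → ℂ := fun i k =>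
    (2 * Real.pi * Complex.I)⁻¹ * ∑ a, (potCoeff i a k : ℂ) * fh a k with hV
  have hVm : ∀ i, AEStronglyMeasurable (V i) (volume : Measure Plane) := fun i =>
    (Finset.aestronglyMeasurable_fun_sum _ fun a _ =>
      (Complex.measurable_ofReal.comp (measurable_potCoeff i a)).aestronglyMeasurable.mul
        (hfhm a).1).const_mul _
  have hV2 : ∀ i, MemLp (fun k => (‖k‖ : ℂ) * V i k) 2 (volume : Measure Plane) := by
    intro i
    have h := (memLp_finsetSum Finset.univ fun a _ => memLp_real_mul
      (measurable_norm.mul (measurable_potCoeff i a)) (abs_norm_mul_potCoeff_le i a)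
      (hfhm a)).const_mul (2 * Real.pi * Complex.I)⁻¹
    refine (memLp_congr_ae (Eventually.of_forall fun k => ?_)).1 h
    simp only [hV, Finset.mul_sum, Pi.mul_apply]
    exact Finset.sum_congr rfl fun a _ => by push_cast; ring
  choose v hvl hv using fun i => exists_locallyIntegrable_primitive (hVm i) (hV2 i)
  refine ⟨fun x i => (v i x).re, s, ⟨hs2, Eventually.of_forall fun x => ?_⟩, ?_, ?_, ?_⟩
  · ext i j
    rw [Matrix.transpose_apply, hsij, hsij]
    have : S j i = S i j := by
      ext k; simp only [hS, perpSymbol, mul_comm (perp k j)]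
    rw [this]
  · intro φ hφ i
    rw [integral_finsetSum _ fun j _ => integrable_mul_isTest (hs2 i j) (hφ.pd j)]
    have hi : ∀ j, Integrable (fun k => 𝓕⁻ (toC (pd j φ)) k * S i j k) := fun j =>
      (hφ.pd j).memLp_fourierInv.integrable_mul (hSm i j)
    have : ∀ j, ∫ x, s x i j * pd j φ x = (∫ k, 𝓕⁻ (toC (pd j φ)) k * S i j k).re :=
      fun j => (hφ.pd j).integral_re_l2FourierInv_mul (hSm i j)
    simp only [this]
    rw [← Complex.re_sum, ← integral_finsetSum _ fun j _ => hi j]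
    have hz : ∀ k, ∑ j, 𝓕⁻ (toC (pd j φ)) k * S i j k = 0 := by
      intro k
      simp only [Fin.sum_univ_two, hφ.fourierInv_pd, hS, perpSymbol, perp]
      push_cast
      simp
      ring
    simp [hz]
  · intro x
    choose t ht hit using fun i => hvl i x
    refine ⟨t 0 ∩ t 1, inter_mem (ht 0) (ht 1), ?_⟩
    refine Integrable.of_eval fun i => ?_
    fin_cases i
    · exact ((hit 0).mono_set Set.inter_subset_left).re
    · exact ((hit 1).mono_set Set.inter_subset_right).re
  · intro φ hφ i j
    have hA : ∀ i j, ∫ x, (v i x).re * pd j φ x = (∫ k, 𝓕⁻ (toC (pd j φ)) k * V i k).re := by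
      intro i j
      rw [← hv i φ hφ j]
      exact integral_re_mul ((hvl i).integrable_smul_left_of_hasCompactSupport
        (hφ.pd j).contDiff_toC.continuous (hφ.pd j).hasCompactSupport_toC)
    have hAi : ∀ i j, Integrable (fun k => 𝓕⁻ (toC (pd j φ)) k * V i k) :=
      fun i j => integrable_mul_fourierInv_pd (hVm i) (hV2 i) hφ j
    have hui : ∀ i j, Integrable (fun x => (v i x).re * pd j φ x) := by
      intro i j
      have := ((hvl i).integrable_smul_left_of_hasCompactSupport
        (hφ.pd j).contDiff_toC.continuous (hφ.pd j).hasCompactSupport_toC).re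
      refine this.congr (Eventually.of_forall fun x => ?_)
      simp [mul_comm]
    have hfi : Integrable (fun k => 𝓕⁻ (toC φ) k * fh (i, j) k) :=
      hφ.memLp_fourierInv.integrable_mul (hfhm (i, j))
    have hSi : Integrable (fun k => 𝓕⁻ (toC φ) k * S i j k) :=
      hφ.memLp_fourierInv.integrable_mul (hSm i j)
    have hl : ∫ x, (f x i j - s x i j) * φ x
        = (∫ k, 𝓕⁻ (toC φ) k * (fh (i, j) k - S i j k)).re := by
      simp only [sub_mul, mul_sub]
      rw [integral_sub (integrable_mul_isTest (hf2 i j) hφ) (integrable_mul_isTest (hs2 i j) hφ),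
        integral_sub hfi hSi, Complex.sub_re]
      congr 1
      · rw [← Complex.ofReal_re (∫ x, f x i j * φ x), hφ.integral_mul (hf2 i j)]
      · exact hφ.integral_re_l2FourierInv_mul (hSm i j)
    have hr : ∫ x, (1 / 2 : ℝ) * ((v i x).re * pd j φ x + (v j x).re * pd i φ x)
        = (∫ k, (1 / 2 : ℂ) * (𝓕⁻ (toC (pd j φ)) k * V i k
          + 𝓕⁻ (toC (pd i φ)) k * V j k)).re := by
      rw [integral_const_mul, integral_const_mul, integral_add (hui i j) (hui j i),
        integral_add (hAi i j) (hAi j i), hA, hA]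
      have e : (1 / 2 : ℂ) = ((1 / 2 : ℝ) : ℂ) := by push_cast; rfl
      rw [e, Complex.re_ofReal_mul, Complex.add_re]
    have hfsymm : fh (1, 0) = fh (0, 1) := by
      refine l2Fourier_congr ?_
      filter_upwards [hsymm] with x hx
      exact congrArg Complex.ofReal (hx.apply 0 1)
    -- The minus sign of the weak derivative cancels that of `fourierInv_pd`; `potCoeff_identity` is
    -- what remains.
    have key : ∫ k, 𝓕⁻ (toC φ) k * (fh (i, j) k - S i j k)
        = -∫ k, (1 / 2 : ℂ) * (𝓕⁻ (toC (pd j φ)) k * V i k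
          + 𝓕⁻ (toC (pd i φ)) k * V j k) := by
      rw [← integral_neg]
      refine integral_congr_ae ?_
      filter_upwards [ae_norm_sq_ne_zero] with k hk
      have hid := potCoeff_identity hk (F := fun i j => fh (i, j) k) (congrFun hfsymm k) i j
      have hc : (2 * Real.pi * Complex.I : ℂ) * (2 * Real.pi * Complex.I)⁻¹ = 1 :=
        mul_inv_cancel₀ (by simp [Real.pi_ne_zero])
      simp only [hφ.fourierInv_pd, hV, hS, hT]
      rw [← hid]
      linear_combination (-(1 / 2) * 𝓕⁻ (toC φ) k *
        (k j * ∑ a : Fin 2 × Fin 2, (potCoeff i a k : ℂ) * fh a k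
        + k i * ∑ a : Fin 2 × Fin 2, (potCoeff j a k : ℂ) * fh a k)) * hc
    have e : ∫ x, (f x - s x) i j * φ x = ∫ x, (f x i j - s x i j) * φ x := rfl
    rw [e, hl, hr, key, Complex.neg_re]

end

end ScalarFBP

end

theorem mainTheorem3 :
    -- the scalar filtered back projection is the trace of the solenoidal part
    (∀ f : ScalarFBP.TensorField, ScalarFBP.IsL2SymTensor f →
      (∃ (u : ScalarFBP.Plane → Fin 2 → ℝ) (s : ScalarFBP.TensorField),
        ScalarFBP.IsHelmholtz f u s) ∧
      ∀ (u : ScalarFBP.Plane → Fin 2 → ℝ) (s : ScalarFBP.TensorField),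
        ScalarFBP.IsHelmholtz f u s → ScalarFBP.FBPEq f (fun x => (s x).trace)) ∧
    -- traction-free strain fields under plane-stress or plane-strain conditions
    (∀ (E ν : ℝ), E ≠ 0 → 1 + ν ≠ 0 → 1 - 2 * ν ≠ 0 →
      ∀ Ω : Set ScalarFBP.Plane, IsOpen Ω → Bornology.IsBounded Ω →
      ∀ ε : ScalarFBP.TensorField3, ScalarFBP.IsStrainField Ω ε →
        ScalarFBP.Equilibrium Ω (ScalarFBP.inPlane (ScalarFBP.stress E ν ε)) →
        ScalarFBP.TractionFree Ω (ScalarFBP.inPlane (ScalarFBP.stress E ν ε)) →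
        (ScalarFBP.PlaneStress (ScalarFBP.stress E ν ε) →
          ScalarFBP.FBPEq (ScalarFBP.inPlane ε)
            (fun x => 1 / E * (ScalarFBP.inPlane (ScalarFBP.stress E ν ε) x).trace)) ∧
        (ScalarFBP.PlaneStrain ε →
          ScalarFBP.FBPEq (ScalarFBP.inPlane ε)
            (fun x => (1 - ν ^ 2) / E
              * (ScalarFBP.inPlane (ScalarFBP.stress E ν ε) x).trace))) := by
  refine ⟨fun f hf => ⟨ScalarFBP.exists_isHelmholtz hf, fun u s h => ?_⟩, ?_⟩
  · exact (h.symbolRel hf.1).fbpEq hf.1 (ScalarFBP.memLp_trace h.l2.1)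
  · intro E ν hE h1 h2 Ω _ _ ε hε _ ht
    exact ScalarFBP.fbpEq_of_tractionFree hE h1 h2 hε ht
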